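/- Let $N=\{q=0\}\subset\mathbb R^4$ be a hyperquadric ($q$ a polynomial of degree two) which is regular and locally strictly convex: at each point its tangent hyperplane supports it locally with nondegenerate contact. Let $\mathfrak G$ be the Blaschke metric of $N$, that is $\mathfrak G(V,W)=H(V,W)/(\det H(X_i,X_j))^{1/5}$ with $H(V,W)=[X_1,X_2,X_3,D_WV]$ for any local tangent frame $(X_1,X_2,X_3)$ of $N$, where $D$ is the flat connection of $\mathbb R^4$ and $[\cdot,\cdot,\cdot,\cdot]$ the determinant. Let $M$ be a smooth surface immersed in $\mathbb R^4$ with image in $N$ (then $M$ is locally strictly convex), and let $g=\mathfrak G|_M$. A transversal plane bundle $\sigma$ over an open set $U\subset M$ is a smooth field of planes $\sigma_x$ with $\mathbb R^4=T_xM\oplus\sigma_x$; it induces a connection $\nabla$ on $U$ by letting $\nabla_XY$ be the tangential part of $D_XY$. It is equiaffine if $\nabla\omega_g=0$, where $\omega_g$ is the area form of $g$. An equiaffine $\sigma$ is called symmetric, respectively antisymmetric, if for $g$-orthonormal tangent frames $(X_1,X_2)$ $$(\nabla g)(X_2,X_1,X_1)\mp(\nabla g)(X_1,X_2,X_1)=0,\qquad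 (\nabla g)(X_1,X_2,X_2)\mp(\nabla g)(X_2,X_1,X_2)=0,$$ with the sign $-$ for symmetric and $+$ for antisymmetric, where $(\nabla g)(X,Y,Z)=X(g(Y,Z))-g(\nabla_XY,Z)-g(Y,\nabla_XZ)$. A point $x\in M$ is an inflection if there is a nonzero linear form $\lambda$ on $\mathbb R^4$ that vanishes on $T_xM$ and satisfies $\lambda(D_XY)=0$ at $x$ for all tangent fields $X,Y$ of $M$. An affine normal field of $N$ is a smooth transversal field $Y$ along $N$ such that $D_WY$ is tangent to $N$ for every tangent $W$, and $[X_1,X_2,X_3,Y]^2=|\det h(X_i,X_j)|$ for all tangent $X_1,X_2,X_3$, where $h$ is the affine fundamental form of $Y$, defined by $D_WV\equiv h(V,W)\,Y$ modulo $TN$ ($Y$ is unique up to sign). Then $N$ has an affine normal field. Moreover, over every open set $U\subset M$ without inflections there are a unique antisymmetric and a unique symmetric equiaffine plane bundle with respect to $g=\mathfrak G|_M$, and both contain the affine normal of $N$: $Y_x\in\sigma_x$ for every $x\in U$, every affine normal field $Y$ of $N$, and $\sigma$ either of the two bundles. -/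

import Mathlib

open Set Filter
open scoped Topology Manifold ContDiff

namespace AffineSurface

noncomputable section

/-- Affine 4-space. -/
abbrev E4 := EuclideanSpace ℝ (Fin 4)

/-- The determinant `[a, b, c, d]` of four vectors of `ℝ⁴`. -/
def det4 (a b c d : E4) : ℝ :=
  Matrix.det (Matrix.of fun i j : Fin 4 => (![a, b, c, d] i) j)

/-! ### Hypersurfaces `N = {q = 0}` of `ℝ⁴` -/

/-- The hypersurface with equation `q = 0`. -/
def zeroSet (q : E4 → ℝ) : Set E4 := {y | q y = 0}

/-- The tangent space of `{q = 0}` at `p` (a hyperplane wherever `dq ≠ 0`). -/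
def hyperTangent (q : E4 → ℝ) (p : E4) : Submodule ℝ E4 :=
  LinearMap.ker (fderiv ℝ q p : E4 →ₗ[ℝ] ℝ)

/-- A vector field extending `v` (for `v` tangent at a point) which is tangent to the level sets
of `q`. It only serves to compute the derivatives `D_w V` of tangent fields modulo the tangent
space, which do not depend on the extension, see `fderiv_tangent_field`. -/
def tangentExt (q : E4 → ℝ) (v : E4) : E4 → E4 := fun y =>
  v - (fderiv ℝ q y v / ‖gradient q y‖ ^ 2) • gradient q y

/-- `D_w V` at `p`, for a field `V` tangent to `{q = 0}` with `V p = v`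
(well defined modulo the tangent space). -/
def hyperD (q : E4 → ℝ) (p w v : E4) : E4 := fderiv ℝ (tangentExt q v) p w

/-! The derivative of a tangent field, modulo the tangent space, depends only on its value. -/

theorem differentiableAt_tangentExt {q : E4 → ℝ} {p : E4} (hq : ContDiffAt ℝ 2 q p)
    (hp : fderiv ℝ q p ≠ 0) (v : E4) : ContDiffAt ℝ 1 (tangentExt q v) p := by
  have h1 : ContDiffAt ℝ 1 (fderiv ℝ q) p := hq.fderiv_right (by norm_num)
  have h2 : ContDiffAt ℝ 1 (gradient q) p :=
    (InnerProductSpace.toDual ℝ E4).symm.contDiff.contDiffAt.comp p h1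
  have h3 : gradient q p ≠ 0 := by
    simpa [gradient] using hp
  unfold tangentExt
  refine contDiffAt_const.sub (ContDiffAt.smul (ContDiffAt.div ?_ ?_ ?_) h2)
  · exact h1.clm_apply contDiffAt_const
  · exact h2.norm_sq ℝ
  · positivity

theorem tangentExt_mem {q : E4 → ℝ} {y : E4} (hy : fderiv ℝ q y ≠ 0) (v : E4) :
    tangentExt q v y ∈ hyperTangent q y := by
  have h3 : gradient q y ≠ 0 := by simpa [gradient] using hy
  have h4 : fderiv ℝ q y (gradient q y) = ‖gradient q y‖ ^ 2 := by
    have : fderiv ℝ q y = InnerProductSpace.toDual ℝ E4 (gradient q y) := by simp [gradient]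
    rw [this, InnerProductSpace.toDual_apply_apply, real_inner_self_eq_norm_sq]
  have h5 : ‖gradient q y‖ ≠ 0 := norm_ne_zero_iff.2 h3
  change fderiv ℝ q y (tangentExt q v y) = 0
  simp only [tangentExt, map_sub, map_smul, smul_eq_mul, h4]
  field_simp
  ring

theorem tangentExt_self {q : E4 → ℝ} {p v : E4} (hv : v ∈ hyperTangent q p) :
    tangentExt q v p = v := by
  have : fderiv ℝ q p v = 0 := hv
  simp [tangentExt, this]

theorem fderiv_fderiv_tangent_field {q : E4 → ℝ} {p : E4} (hq : ContDiffAt ℝ 2 q p)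
    (hp0 : p ∈ zeroSet q) (hp : fderiv ℝ q p ≠ 0) {V : E4 → E4} (hV : ContDiffAt ℝ 1 V p)
    (hVt : ∀ᶠ y in 𝓝[zeroSet q] p, V y ∈ hyperTangent q y) {w : E4}
    (hw : w ∈ hyperTangent q p) :
    fderiv ℝ q p (fderiv ℝ V p w) = - fderiv ℝ (fderiv ℝ q) p w (V p) := by
  have h1 : ContDiffAt ℝ 1 (fderiv ℝ q) p := hq.fderiv_right (by norm_num)
  have h2 : ContDiffAt ℝ 1 (fun y => fderiv ℝ q y (V y)) p := h1.clm_apply hV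
  have hs := h2.hasStrictFDerivAt (by norm_num)
  have hqs := hq.hasStrictFDerivAt (by norm_num)
  have hpp : fderiv ℝ q p (V p) = 0 := hVt.self_of_nhdsWithin hp0
  have hset : {x | q x = q p} = zeroSet q := by
    have : q p = 0 := hp0
    simp [zeroSet, this]
  have hext : IsLocalExtrOn (fun y => fderiv ℝ q y (V y)) {x | q x = q p} p := by
    left
    rw [hset]
    filter_upwards [hVt] with y hy
    have : fderiv ℝ q y (V y) = 0 := hy
    simp [hpp, this]
  obtain ⟨a, b, hab, h⟩ := hext.exists_multipliers_of_hasStrictFDerivAt_1d hqs hs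
  have hb : b ≠ 0 := by
    rintro rfl
    have ha : a ≠ 0 := by
      rintro rfl
      exact hab rfl
    simp [ha, hp] at h
  have hd : fderiv ℝ (fun y => fderiv ℝ q y (V y)) p w =
      fderiv ℝ q p (fderiv ℝ V p w) + fderiv ℝ (fderiv ℝ q) p w (V p) := by
    rw [fderiv_clm_apply (h1.differentiableAt (by norm_num)) (hV.differentiableAt (by norm_num))]
    simp
  have hw' : fderiv ℝ q p w = 0 := hw
  have := congrArg (fun L => L w) h
  simp [hw', hd, hb] at this
  linarith

theorem fderiv_tangent_field {q : E4 → ℝ} {p : E4} (hq : ContDiffAt ℝ 2 q p)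
    (hp0 : p ∈ zeroSet q) (hp : fderiv ℝ q p ≠ 0) {V : E4 → E4} (hV : ContDiffAt ℝ 1 V p)
    (hVt : ∀ᶠ y in 𝓝[zeroSet q] p, V y ∈ hyperTangent q y) {w : E4}
    (hw : w ∈ hyperTangent q p) :
    fderiv ℝ V p w - hyperD q p w (V p) ∈ hyperTangent q p := by
  have hVp : V p ∈ hyperTangent q p := hVt.self_of_nhdsWithin hp0
  have hne : ∀ᶠ y in 𝓝 p, fderiv ℝ q y ≠ 0 :=
    (hq.fderiv_right (m := 1) (by norm_num)).continuousAt.eventually_ne hp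
  have h1 := fderiv_fderiv_tangent_field hq hp0 hp hV hVt hw
  have h2 := fderiv_fderiv_tangent_field hq hp0 hp (differentiableAt_tangentExt hq hp (V p))
    (eventually_nhdsWithin_of_eventually_nhds
      (hne.mono fun y hy => tangentExt_mem hy (V p))) hw
  rw [tangentExt_self hVp] at h2
  change fderiv ℝ q p (fderiv ℝ V p w - fderiv ℝ (tangentExt q (V p)) p w) = 0
  rw [map_sub, h1, h2, sub_self]

/-- The hypersurface `{q = 0}` is regular and locally strictly convex: at each of its points `p` the
tangent hyperplane supports it locally, with a nondegenerate contact, i.e. the Hessian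
`(v, w) ↦ dq_p (D_w V)` of the height function `y ↦ dq_p (y - p)` on the hypersurface is
nondegenerate at `p`. -/
def IsLocallyStrictlyConvex (q : E4 → ℝ) : Prop :=
  ∀ p ∈ zeroSet q, fderiv ℝ q p ≠ 0 ∧
    ((∀ᶠ y in 𝓝[zeroSet q] p, 0 ≤ fderiv ℝ q p (y - p)) ∨
      (∀ᶠ y in 𝓝[zeroSet q] p, fderiv ℝ q p (y - p) ≤ 0)) ∧
    ∀ v ∈ hyperTangent q p,
      (∀ w ∈ hyperTangent q p, fderiv ℝ q p (hyperD q p w v) = 0) → v = 0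

/-- `q` is a polynomial of degree exactly two, so that `{q = 0}` is a hyperquadric. -/
def IsQuadratic (q : E4 → ℝ) : Prop :=
  ∃ (B : LinearMap.BilinForm ℝ E4) (l : E4 →ₗ[ℝ] ℝ) (c : ℝ),
    B.IsSymm ∧ B ≠ 0 ∧ ∀ x, q x = B x x + l x + c

/-- `u` is a basis of the tangent space of `{q = 0}` at `p`. -/
def IsHyperFrame (q : E4 → ℝ) (p : E4) (u : Fin 3 → E4) : Prop :=
  LinearIndependent ℝ u ∧ Submodule.span ℝ (range u) = hyperTangent q p

/-- The form `H_u(v, w) = [u₁, u₂, u₃, D_w V]`. -/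
def frameForm (q : E4 → ℝ) (p : E4) (u : Fin 3 → E4) (v w : E4) : ℝ :=
  det4 (u 0) (u 1) (u 2) (hyperD q p w v)

/-- The real fifth root. -/
def fifthRoot (d : ℝ) : ℝ := Real.sign d * |d| ^ (1 / 5 : ℝ)

/-- `H_u / (det_u H_u)^{1/5}`. -/
def normalizedForm (q : E4 → ℝ) (p : E4) (u : Fin 3 → E4) (v w : E4) : ℝ :=
  frameForm q p u v w /
    fifthRoot (Matrix.det (Matrix.of fun i j : Fin 3 => frameForm q p u (u i) (u j)))

open Classical in
/-- The Blaschke metric of `{q = 0}`: the form `H_u / (det_u H_u)^{1/5}`, for any basis `u` of the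
tangent space at `p`; it does not depend on `u`, see `blaschke_eq`. -/
def blaschke (q : E4 → ℝ) (p v w : E4) : ℝ :=
  if h : ∃ u, IsHyperFrame q p u then normalizedForm q p h.choose v w else 0

/-! The Blaschke metric can be computed in any tangent basis. -/

theorem hyperD_sum {q : E4 → ℝ} {p : E4} (hq : ContDiffAt ℝ 2 q p)
    (hp : fderiv ℝ q p ≠ 0) (w : E4) (c : Fin 3 → ℝ) (v : Fin 3 → E4) :
    hyperD q p w (∑ k, c k • v k) = ∑ k, c k • hyperD q p w (v k) := by
  have hd : ∀ k, DifferentiableAt ℝ (tangentExt q (v k)) p := fun k =>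
    (differentiableAt_tangentExt hq hp (v k)).differentiableAt (by norm_num)
  have : tangentExt q (∑ k, c k • v k) = ∑ k, c k • tangentExt q (v k) := by
    funext y
    simp only [tangentExt, Finset.sum_apply, Pi.smul_apply, smul_sub, Finset.sum_sub_distrib,
      map_sum, map_smul, Finset.sum_div, Finset.sum_smul, smul_smul, smul_eq_mul, mul_div_assoc]
  unfold hyperD
  rw [this, fderiv_sum fun k _ => (hd k).const_smul (c k)]
  simp [fderiv_const_smul (hd _)]

theorem det4_frame_change (A : Matrix (Fin 3) (Fin 3) ℝ) (u : Fin 3 → E4) (z : E4) :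
    det4 (∑ k, A 0 k • u k) (∑ k, A 1 k • u k) (∑ k, A 2 k • u k) z =
      A.det * det4 (u 0) (u 1) (u 2) z := by
  have h : (Matrix.of fun i j : Fin 4 =>
      (![∑ k, A 0 k • u k, ∑ k, A 1 k • u k, ∑ k, A 2 k • u k, z] i) j) =
      !![A 0 0, A 0 1, A 0 2, 0; A 1 0, A 1 1, A 1 2, 0; A 2 0, A 2 1, A 2 2, 0; 0, 0, 0, 1] *
      (Matrix.of fun i j : Fin 4 => (![u 0, u 1, u 2, z] i) j) := by
    ext i j
    fin_cases i <;> simp [Matrix.mul_apply, Fin.sum_univ_succ]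
  unfold det4
  rw [h, Matrix.det_mul]
  congr 1
  simp [Matrix.det_succ_row_zero, Fin.sum_univ_succ, Fin.succAbove]

theorem det4_sum_right (a b c : E4) (d : Fin 3 → ℝ) (z : Fin 3 → E4) :
    det4 a b c (∑ k, d k • z k) = ∑ k, d k * det4 a b c (z k) := by
  simp [det4, Matrix.det_succ_row_zero, Fin.sum_univ_succ, Fin.succAbove]
  ring

theorem fifthRoot_mul_pow {a : ℝ} (ha : a ≠ 0) (d : ℝ) :
    fifthRoot (a ^ 5 * d) = a * fifthRoot d := by
  have h1 : |a ^ 5 * d| ^ (1 / 5 : ℝ) = |a| * |d| ^ (1 / 5 : ℝ) := by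
    rw [abs_mul, Real.mul_rpow (abs_nonneg _) (abs_nonneg _), abs_pow]
    congr 1
    rw [← Real.rpow_natCast, ← Real.rpow_mul (abs_nonneg _)]
    norm_num
  have h2 : Real.sign (a ^ 5 * d) = Real.sign a * Real.sign d := by
    rcases lt_or_gt_of_ne ha with h | h <;> rcases lt_trichotomy d 0 with h' | h' | h'
    · rw [Real.sign_of_pos (mul_pos_of_neg_of_neg (Odd.pow_neg (by decide) h) h'),
        Real.sign_of_neg h, Real.sign_of_neg h']
      norm_num
    · simp [h']
    · rw [Real.sign_of_neg (mul_neg_of_neg_of_pos (Odd.pow_neg (by decide) h) h'),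
        Real.sign_of_neg h, Real.sign_of_pos h']
      norm_num
    · rw [Real.sign_of_neg (mul_neg_of_pos_of_neg (by positivity) h'),
        Real.sign_of_pos h, Real.sign_of_neg h']
      norm_num
    · simp [h']
    · rw [Real.sign_of_pos (by positivity), Real.sign_of_pos h, Real.sign_of_pos h']
      norm_num
  have h3 : Real.sign a * |a| = a := by
    rcases lt_or_gt_of_ne ha with h | h
    · rw [Real.sign_of_neg h, abs_of_neg h]
      ring
    · rw [Real.sign_of_pos h, abs_of_pos h]
      ring
  unfold fifthRoot
  rw [h1, h2]
  calc _ = (Real.sign a * |a|) * (Real.sign d * |d| ^ (1 / 5 : ℝ)) := by ring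
    _ = _ := by rw [h3]

theorem normalizedForm_eq {q : E4 → ℝ} {p : E4} (hq : ContDiffAt ℝ 2 q p)
    (hp : fderiv ℝ q p ≠ 0) {u u' : Fin 3 → E4} (hu : IsHyperFrame q p u)
    (hu' : IsHyperFrame q p u') (v w : E4) :
    normalizedForm q p u' v w = normalizedForm q p u v w := by
  have hc : ∀ i, ∃ c : Fin 3 → ℝ, ∑ k, c k • u k = u' i := fun i => by
    have : u' i ∈ Submodule.span ℝ (range u) := by
      rw [hu.2, ← hu'.2]
      exact Submodule.subset_span (mem_range_self i)
    exact (Submodule.mem_span_range_iff_exists_fun ℝ).1 this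
  choose c hc using hc
  set A : Matrix (Fin 3) (Fin 3) ℝ := Matrix.of c with hA
  have hA' : ∀ i, u' i = ∑ k, A i k • u k := fun i => by simp [hA, hc]
  have hdet : A.det ≠ 0 := by
    intro h0
    obtain ⟨b, hb, hbA⟩ := Matrix.exists_vecMul_eq_zero_iff.2 h0
    refine hb (funext fun i => Fintype.linearIndependent_iff.1 hu'.1 b ?_ i)
    simp only [hA', Finset.smul_sum, smul_smul]
    rw [Finset.sum_comm]
    refine Finset.sum_eq_zero fun k _ => ?_
    rw [← Finset.sum_smul]
    have := congrFun hbA k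
    simp only [Matrix.vecMul, dotProduct, Pi.zero_apply] at this
    rw [this, zero_smul]
  have h1 : ∀ v w, frameForm q p u' v w = A.det * frameForm q p u v w := fun v w => by
    unfold frameForm
    rw [hA' 0, hA' 1, hA' 2, det4_frame_change]
  have h2 : ∀ i j, frameForm q p u (u' i) (u' j) =
      ∑ k, A i k * ∑ l, A j l * frameForm q p u (u k) (u l) := fun i j => by
    unfold frameForm
    rw [hA' i, hyperD_sum hq hp, det4_sum_right]
    refine Finset.sum_congr rfl fun k _ => ?_
    congr 1
    rw [hA' j, ← det4_sum_right]
    simp [hyperD]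
  have h3 : (Matrix.of fun i j : Fin 3 => frameForm q p u' (u' i) (u' j)) =
      A.det • (A * (Matrix.of fun i j : Fin 3 => frameForm q p u (u i) (u j)) * A.transpose) := by
    ext i j
    simp only [Matrix.of_apply, h1, h2, Matrix.smul_apply, Matrix.mul_apply,
      Matrix.transpose_apply, smul_eq_mul, Finset.mul_sum, Finset.sum_mul]
    rw [Finset.sum_comm]
    refine Finset.sum_congr rfl fun k _ => Finset.sum_congr rfl fun l _ => ?_
    ring
  unfold normalizedForm
  rw [h3, h1, Matrix.det_smul, Matrix.det_mul, Matrix.det_mul, Matrix.det_transpose,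
    Fintype.card_fin]
  rw [show A.det ^ 3 * (A.det * (Matrix.of fun i j : Fin 3 => frameForm q p u (u i) (u j)).det *
    A.det) = A.det ^ 5 * (Matrix.of fun i j : Fin 3 => frameForm q p u (u i) (u j)).det by ring,
    fifthRoot_mul_pow hdet, mul_div_mul_left _ _ hdet]

theorem blaschke_eq {q : E4 → ℝ} {p : E4} (hq : ContDiffAt ℝ 2 q p)
    (hp : fderiv ℝ q p ≠ 0) {u : Fin 3 → E4} (hu : IsHyperFrame q p u) (v w : E4) :
    blaschke q p v w = normalizedForm q p u v w := by
  have h : ∃ u, IsHyperFrame q p u := ⟨u, hu⟩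
  unfold blaschke
  rw [dif_pos h]
  exact normalizedForm_eq hq hp hu h.choose_spec v w

/-- `Y` is an affine normal field of `{q = 0}`: it is smooth and transversal to the hypersurface, it
is equiaffine (`D_w Y` is tangent for tangent `w`), and the volume form
`[·, ·, ·, Y]` induced by `Y` is, up to sign, the volume form of the affine fundamental form `h` of
`Y`, which is given by `D_w V = ∇_w V + h(V, w) Y`. (`Y` is unique up to sign.) -/
structure IsAffineNormal (q : E4 → ℝ) (Y : E4 → E4) : Prop where
  smooth : ∀ p ∈ zeroSet q, ContDiffAt ℝ ∞ Y p
  transversal : ∀ p ∈ zeroSet q, Y p ∉ hyperTangent q p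
  equiaffine : ∀ p ∈ zeroSet q, ∀ w ∈ hyperTangent q p, fderiv ℝ Y p w ∈ hyperTangent q p
  volume : ∀ p ∈ zeroSet q, ∀ u : Fin 3 → E4, (∀ i, u i ∈ hyperTangent q p) →
    ∀ h : Matrix (Fin 3) (Fin 3) ℝ,
      (∀ i j, hyperD q p (u j) (u i) - h i j • Y p ∈ hyperTangent q p) →
      det4 (u 0) (u 1) (u 2) (Y p) ^ 2 = |h.det|

/-! ### Surfaces immersed in `ℝ⁴` -/

section Surface

variable {M : Type*} [TopologicalSpace M] [ChartedSpace (EuclideanSpace ℝ (Fin 2)) M]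

/-- `f : M → ℝ⁴` is a smooth immersion of the surface `M`. -/
def IsSmoothImmersion (f : M → E4) : Prop :=
  ContMDiff (𝓡 2) 𝓘(ℝ, E4) ∞ f ∧ ∀ x, Function.Injective (mfderiv (𝓡 2) 𝓘(ℝ, E4) f x)

/-- The differential of `f` at `x`, with values in `ℝ⁴`. -/
def dmap (f : M → E4) (x : M) : TangentSpace (𝓡 2) x →ₗ[ℝ] E4 :=
  (mfderiv (𝓡 2) 𝓘(ℝ, E4) f x).toLinearMap

/-- The tangent plane of the immersed surface, as a subspace of `ℝ⁴`. -/
def tangentPlane (f : M → E4) (x : M) : Submodule ℝ E4 := LinearMap.range (dmap f x)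

variable (M) in
/-- Tangent vector fields on `M`. -/
abbrev VField := ∀ x : M, TangentSpace (𝓡 2) x

/-- The vector field `X` is smooth at `x`. -/
def VField.SmoothAt [IsManifold (𝓡 2) ∞ M] (X : VField M) (x : M) : Prop :=
  ContMDiffAt (𝓡 2) (𝓡 2).tangent ∞ (fun y => (⟨y, X y⟩ : TangentBundle (𝓡 2) M)) x

/-- The derivative `X φ` at `x` of a function `φ` on `M`. -/
def derivAlong (X : VField M) (φ : M → ℝ) (x : M) : ℝ :=
  mfderiv (𝓡 2) 𝓘(ℝ, ℝ) φ x (X x)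

/-- `D_X Y` at `x`, where `D` is the flat connection of `ℝ⁴`. -/
def flatD (f : M → E4) (X Y : VField M) (x : M) : E4 :=
  mfderiv (𝓡 2) 𝓘(ℝ, E4) (fun y => dmap f y (Y y)) x (X x)

/-- `x` is an inflection: some nonzero conormal vector `lam` (a linear form vanishing on the tangent
plane, that is, an element of the dual of any transversal plane) satisfies `lam ∘ h = 0`, where
`h(X, Y)` is the transversal part of `D_X Y`. -/
def IsInflection [IsManifold (𝓡 2) ∞ M] (f : M → E4) (x : M) : Prop :=
  ∃ lam : E4 →ₗ[ℝ] ℝ, lam ≠ 0 ∧ (∀ v ∈ tangentPlane f x, lam v = 0) ∧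
    ∀ X Y : VField M, X.SmoothAt x → Y.SmoothAt x → lam (flatD f X Y x) = 0

/-- `σ` is a (smooth) transversal plane bundle over the open set `U` of `M`. -/
def IsTransversalBundle (f : M → E4) (σ : M → Submodule ℝ E4) (U : Set M) : Prop :=
  (∀ x ∈ U, IsCompl (tangentPlane f x) (σ x)) ∧
  ∀ x ∈ U, ∃ V : Set M, IsOpen V ∧ x ∈ V ∧ V ⊆ U ∧ ∃ ξ₁ ξ₂ : M → E4,
    ContMDiffOn (𝓡 2) 𝓘(ℝ, E4) ∞ ξ₁ V ∧ ContMDiffOn (𝓡 2) 𝓘(ℝ, E4) ∞ ξ₂ V ∧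
    ∀ y ∈ V, σ y = Submodule.span ℝ {ξ₁ y, ξ₂ y}

open Classical in
/-- The connection `∇ = ∇(σ)` induced by the transversal plane bundle `σ`: `∇_X Y` is the
tangential part of `D_X Y` in the splitting `ℝ⁴ = T_x M ⊕ σ_x`. -/
def inducedConn (f : M → E4) (σ : M → Submodule ℝ E4) (X Y : VField M) : VField M := fun x =>
  if h : Function.Injective (dmap f x) ∧ IsCompl (LinearMap.range (dmap f x)) (σ x) then
    LinearMap.linearProjOfIsCompl (σ x) (dmap f x) h.1 h.2 (flatD f X Y x)
  else 0

/-- `(∇g)(X, Y, Z) = X (g(Y, Z)) - g(∇_X Y, Z) - g(Y, ∇_X Z)` at `x`. -/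
def nablaMetric (f : M → E4) (σ : M → Submodule ℝ E4)
    (g : ∀ x : M, TangentSpace (𝓡 2) x → TangentSpace (𝓡 2) x → ℝ)
    (X Y Z : VField M) (x : M) : ℝ :=
  derivAlong X (fun y => g y (Y y) (Z y)) x
    - g x (inducedConn f σ X Y x) (Z x) - g x (Y x) (inducedConn f σ X Z x)

/-- The area form of a metric `g` on a plane, oriented by the basis `(e₁, e₂)`: this is
`± √(g(v, v) g(w, w) - g(v, w)²)`, with the sign of the basis `(v, w)`,
see `areaForm_coord` and `areaForm_sq`. -/
def areaForm {V : Type*} (g : V → V → ℝ) (e₁ e₂ v w : V) : ℝ :=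
  (g v e₁ * g w e₂ - g v e₂ * g w e₁) / √(g e₁ e₁ * g e₂ e₂ - g e₁ e₂ ^ 2)

theorem areaForm_aux {V : Type*} [AddCommGroup V] [Module ℝ V] (g : LinearMap.BilinForm ℝ V)
    (hg : g.IsSymm) (e₁ e₂ : V) (a b c d : ℝ) :
    g (a • e₁ + b • e₂) e₁ * g (c • e₁ + d • e₂) e₂ -
        g (a • e₁ + b • e₂) e₂ * g (c • e₁ + d • e₂) e₁ =
      (a * d - b * c) * (g e₁ e₁ * g e₂ e₂ - g e₁ e₂ ^ 2) := by
  have h := hg.eq e₁ e₂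
  simp only [map_add, map_smul, LinearMap.add_apply, LinearMap.smul_apply, smul_eq_mul, ← h]
  ring

/-- For `v = a e₁ + b e₂` and `w = c e₁ + d e₂`, the area form is
`ω(v, w) = (a d - b c) √(det g(eᵢ, eⱼ))`. -/
theorem areaForm_coord {V : Type*} [AddCommGroup V] [Module ℝ V] (g : LinearMap.BilinForm ℝ V)
    (hg : g.IsSymm) (e₁ e₂ : V) (a b c d : ℝ) :
    areaForm (fun x y => g x y) e₁ e₂ (a • e₁ + b • e₂) (c • e₁ + d • e₂) =
      (a * d - b * c) * √(g e₁ e₁ * g e₂ e₂ - g e₁ e₂ ^ 2) := by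
  simp only [areaForm]
  rw [areaForm_aux g hg, mul_div_assoc, Real.div_sqrt]

/-- Its square is the Gram determinant of `(v, w)`. -/
theorem areaForm_sq {V : Type*} [AddCommGroup V] [Module ℝ V] (g : LinearMap.BilinForm ℝ V)
    (hg : g.IsSymm) (e₁ e₂ : V) (hpos : 0 < g e₁ e₁ * g e₂ e₂ - g e₁ e₂ ^ 2) (a b c d : ℝ)
    (v w : V) (hv : v = a • e₁ + b • e₂) (hw : w = c • e₁ + d • e₂) :
    areaForm (fun x y => g x y) e₁ e₂ v w ^ 2 = g v v * g w w - g v w ^ 2 := by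
  have h := hg.eq e₁ e₂
  rw [hv, hw, areaForm_coord g hg e₁ e₂, mul_pow, Real.sq_sqrt hpos.le]
  simp only [map_add, map_smul, LinearMap.add_apply, LinearMap.smul_apply, smul_eq_mul, ← h]
  ring

/-- `(∇_X ω)(Y, Z) = X (ω(Y, Z)) - ω(∇_X Y, Z) - ω(Y, ∇_X Z)` at `x`, where `ω` is the area form
of `g` for the orientation given by the local frame `(E₁, E₂)`. -/
def nablaArea (f : M → E4) (σ : M → Submodule ℝ E4)
    (g : ∀ x : M, TangentSpace (𝓡 2) x → TangentSpace (𝓡 2) x → ℝ)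
    (E₁ E₂ X Y Z : VField M) (x : M) : ℝ :=
  derivAlong X (fun y => areaForm (g y) (E₁ y) (E₂ y) (Y y) (Z y)) x
    - areaForm (g x) (E₁ x) (E₂ x) (inducedConn f σ X Y x) (Z x)
    - areaForm (g x) (E₁ x) (E₂ x) (Y x) (inducedConn f σ X Z x)

variable [IsManifold (𝓡 2) ∞ M]

/-- `σ` is an equiaffine transversal plane bundle over `U` with respect to the metric `g`:
`∇ ω_g = 0`, where `ω_g` is the area form of `g` (for any local orientation). -/
def IsEquiaffine (f : M → E4) (g : ∀ x : M, TangentSpace (𝓡 2) x → TangentSpace (𝓡 2) x → ℝ)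
    (σ : M → Submodule ℝ E4) (U : Set M) : Prop :=
  IsTransversalBundle f σ U ∧
  ∀ x ∈ U, ∀ E₁ E₂ X Y Z : VField M,
    E₁.SmoothAt x → E₂.SmoothAt x → LinearIndependent ℝ ![E₁ x, E₂ x] →
    X.SmoothAt x → Y.SmoothAt x → Z.SmoothAt x → nablaArea f σ g E₁ E₂ X Y Z x = 0

/-- `(X₁, X₂)` is a pair of smooth fields near `x` that is `g`-orthonormal at `x`. -/
def IsOrthonormalFrameAt (g : ∀ x : M, TangentSpace (𝓡 2) x → TangentSpace (𝓡 2) x → ℝ)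
    (X₁ X₂ : VField M) (x : M) : Prop :=
  X₁.SmoothAt x ∧ X₂.SmoothAt x ∧
    g x (X₁ x) (X₁ x) = 1 ∧ g x (X₁ x) (X₂ x) = 0 ∧ g x (X₂ x) (X₂ x) = 1

/-- The equiaffine plane bundle `σ` is symmetric with respect to `g`. (As `∇g` is a tensor, the
conditions only involve the values of the orthonormal frame at `x`.) -/
def IsSymmetricEquiaffine (f : M → E4)
    (g : ∀ x : M, TangentSpace (𝓡 2) x → TangentSpace (𝓡 2) x → ℝ)
    (σ : M → Submodule ℝ E4) (U : Set M) : Prop :=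
  IsEquiaffine f g σ U ∧
  ∀ x ∈ U, ∀ X₁ X₂ : VField M, IsOrthonormalFrameAt g X₁ X₂ x →
    nablaMetric f σ g X₂ X₁ X₁ x - nablaMetric f σ g X₁ X₂ X₁ x = 0 ∧
    nablaMetric f σ g X₁ X₂ X₂ x - nablaMetric f σ g X₂ X₁ X₂ x = 0

/-- The equiaffine plane bundle `σ` is antisymmetric with respect to `g`. -/
def IsAntisymmetricEquiaffine (f : M → E4)
    (g : ∀ x : M, TangentSpace (𝓡 2) x → TangentSpace (𝓡 2) x → ℝ)
    (σ : M → Submodule ℝ E4) (U : Set M) : Prop :=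
  IsEquiaffine f g σ U ∧
  ∀ x ∈ U, ∀ X₁ X₂ : VField M, IsOrthonormalFrameAt g X₁ X₂ x →
    nablaMetric f σ g X₂ X₁ X₁ x + nablaMetric f σ g X₁ X₂ X₁ x = 0 ∧
    nablaMetric f σ g X₁ X₂ X₂ x + nablaMetric f σ g X₂ X₁ X₂ x = 0

/-- The Blaschke metric of the hypersurface `{q = 0}` restricted to a surface immersed in it. -/
def restrictedBlaschke (q : E4 → ℝ) (f : M → E4) (x : M) (v w : TangentSpace (𝓡 2) x) : ℝ :=
  blaschke q (f x) (dmap f x v) (dmap f x w)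

end Surface

end

end AffineSurface

open AffineSurface

/-!
Write `q(x) = B(x, x) + l(x) + c` and `N = {q = 0}`.

The quadric carries the affine field `Z(p) = a p + b`, where `2 B(b, ·) = a l`, which is
`B`-orthogonal to the tangent hyperplanes (`central_orthogonal`) and satisfies `dq(Z) = const` on
`N` (`fderiv_central`). A Gram determinant of the homogenised quadratic form shows that `det B(uᵢ,
uⱼ) = k [u₀, u₁, u₂, Z]²` for tangent vectors of `N`, with a constant `k` (`exists_gram_eq`). This
has three consequences. A constant multiple of `Z` is an affine normal (`exists_isAffineNormal`).
For an arbitrary affine normal `Y`, the function `|dq(Y)|` is constant on `N`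
(`abs_fderiv_affineNormal`), and as `Y` is equiaffine, differentiating it along the surface shows
that `Y` is `B`-orthogonal to the surface (`affineNormal_orthogonal`). Finally, the Blaschke metric
is a constant multiple `s B` of `B` (`exists_blaschke_eq`); it is positive definite, because local
convexity forces `B` to be definite on the tangent hyperplanes (`definite`).

Hence the metric `g` of the surface is the restriction of a constant bilinear form of `ℝ⁴`, and
the connection of the bundle of `B`-orthogonal planes of the surface is the Levi-Civita connection
of `g`. So `∇g = 0` and `∇ω = 0`, and this single bundle is symmetric and antisymmetric at once
(`nablaMetric_normalPlane`, `nablaArea_normalPlane`); it contains `Z` and every affine normal.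

For uniqueness (`eq_normalPlane_of_equations`), the normal plane is spanned by `Z` and by a vector
`ν` tangent to `N`. The second fundamental form in the direction of `Z` is a nonzero multiple of
`g`, the one in the direction of `ν` is some symmetric form `h`. Another transversal plane is given
by the tangential components of `ν` and `Z` along it, that is by four numbers. The equiaffine and
(anti)symmetry conditions are four homogeneous linear equations for them, whose determinant vanishes
only if `h` is a multiple of `g` (`eq_zero_of_equations`); this means that the point is an
inflection.
-/

namespace AffineSurface

noncomputable section

/-! ### Hyperquadrics and their field of `B`-normals -/

/-- `q x = B(x, x) + l x + c`, with `B` a continuous symmetric bilinear form and `l` a continuous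
linear form. -/
structure HasQuadraticForm (q : E4 → ℝ) (B : E4 →L[ℝ] E4 →L[ℝ] ℝ) (l : E4 →L[ℝ] ℝ) (c : ℝ) :
    Prop where
  symm : ∀ x y, B x y = B y x
  eq : ∀ x, q x = B x x + l x + c

theorem IsQuadratic.exists_hasQuadraticForm {q : E4 → ℝ} (hq : IsQuadratic q) :
    ∃ B l c, HasQuadraticForm q B l c := by
  obtain ⟨B, l, c, hB, -, h⟩ := hq
  refine ⟨LinearMap.toContinuousLinearMap
    ((LinearMap.toContinuousLinearMap (𝕜 := ℝ) (E := E4) (F' := ℝ)).toLinearMap ∘ₗ B),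
    LinearMap.toContinuousLinearMap l, c, ⟨fun x y => ?_, fun x => ?_⟩⟩
  · simpa using hB.eq x y
  · simpa using h x

theorem two_le_infty : (2 : WithTop ℕ∞) ≤ ∞ := by
  exact WithTop.coe_le_coe.2 le_top

namespace HasQuadraticForm

variable {q : E4 → ℝ} {B : E4 →L[ℝ] E4 →L[ℝ] ℝ} {l : E4 →L[ℝ] ℝ} {c : ℝ}

theorem hasFDerivAt (H : HasQuadraticForm q B l c) (p : E4) :
    HasFDerivAt q ((2 : ℝ) • B p + l) p := by
  have h1 : HasFDerivAt (fun x => B x x) (B p + B.flip p) p := by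
    simpa [ContinuousLinearMap.ext_iff] using
      (B.hasFDerivAt (x := p)).clm_apply (hasFDerivAt_id p)
  have h2 := (h1.add l.hasFDerivAt).add_const c
  have hq : q = fun x => B x x + l x + c := funext H.eq
  rw [hq]
  refine h2.congr_fderiv (ContinuousLinearMap.ext fun v => ?_)
  change B p v + B v p + l v = 2 * B p v + l v
  rw [H.symm v p]
  ring

theorem fderiv_eq (H : HasQuadraticForm q B l c) : fderiv ℝ q = fun p => (2 : ℝ) • B p + l :=
  funext fun p => (H.hasFDerivAt p).fderiv

theorem fderiv_apply (H : HasQuadraticForm q B l c) (p v : E4) :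
    fderiv ℝ q p v = 2 * B p v + l v := by
  simp [H.fderiv_eq]

theorem fderiv_fderiv_apply (H : HasQuadraticForm q B l c) (p v w : E4) :
    fderiv ℝ (fderiv ℝ q) p w v = 2 * B w v := by
  have : HasFDerivAt (fderiv ℝ q) ((2 : ℝ) • B) p := by
    rw [H.fderiv_eq]
    exact (((2 : ℝ) • B).hasFDerivAt (x := p)).add_const l
  rw [this.fderiv]
  simp

theorem contDiff (H : HasQuadraticForm q B l c) : ContDiff ℝ ∞ q := by
  have hq : q = fun x => B x x + l x + c := funext H.eq
  rw [hq]
  exact ((B.contDiff.clm_apply contDiff_id).add l.contDiff).add contDiff_const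

theorem mem_hyperTangent (H : HasQuadraticForm q B l c) {p v : E4} :
    v ∈ hyperTangent q p ↔ 2 * B p v + l v = 0 := by
  rw [← H.fderiv_apply]
  rfl

theorem fderiv_hyperD (H : HasQuadraticForm q B l c) {p v w : E4} (hp0 : p ∈ zeroSet q)
    (hp : fderiv ℝ q p ≠ 0) (hv : v ∈ hyperTangent q p) (hw : w ∈ hyperTangent q p) :
    fderiv ℝ q p (hyperD q p w v) = -2 * B w v := by
  have hq : ContDiffAt ℝ 2 q p := H.contDiff.contDiffAt.of_le two_le_infty
  have hne : ∀ᶠ y in 𝓝 p, fderiv ℝ q y ≠ 0 :=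
    (hq.fderiv_right (m := 1) (by norm_num)).continuousAt.eventually_ne hp
  have h2 := fderiv_fderiv_tangent_field hq hp0 hp (differentiableAt_tangentExt hq hp v)
    (eventually_nhdsWithin_of_eventually_nhds
      (hne.mono fun y hy => tangentExt_mem hy v)) hw
  rw [tangentExt_self hv, H.fderiv_fderiv_apply] at h2
  rw [hyperD, h2]
  ring

/-- The curve `y(t) = p + s(t) (v + t n)`, with `s(t)` the second root of `q` on the line through
`p` in the direction `v + t n`, stays in the quadric and leaves `p` on the side of the tangent
hyperplane given by the sign of `-B(v, v)`. -/
theorem exists_side (H : HasQuadraticForm q B l c) {p v : E4} (hp0 : p ∈ zeroSet q)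
    (hp : fderiv ℝ q p ≠ 0) (hv : v ∈ hyperTangent q p) (hvv : B v v ≠ 0) {P : ℝ → Prop}
    (hP : ∀ᶠ y in 𝓝[zeroSet q] p, P (fderiv ℝ q p (y - p))) :
    ∃ r, 0 < r ∧ P (-(r * B v v)) := by
  obtain ⟨n, hn⟩ : ∃ n, fderiv ℝ q p n ≠ 0 := by
    by_contra! h
    exact hp (ContinuousLinearMap.ext h)
  set τ := fderiv ℝ q p n with hτ
  set β : ℝ → ℝ := fun t => B (v + t • n) (v + t • n) with hβ
  have hβc : Continuous β := by
    have h1 : Continuous fun t : ℝ => v + t • n := by fun_prop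
    exact (B.continuous.comp h1).clm_apply h1
  have hβ0 : β 0 = B v v := by simp [hβ]
  set s : ℝ → ℝ := fun t => -(t * τ) / β t with hs
  have hsc : ContinuousAt s 0 := by
    refine ContinuousAt.div (by fun_prop) hβc.continuousAt ?_
    rwa [hβ0]
  set y : ℝ → E4 := fun t => p + s t • (v + t • n) with hy
  have hyc : ContinuousAt y 0 := by
    refine continuousAt_const.add (hsc.smul ?_)
    fun_prop
  have hy0 : y 0 = p := by simp [hy, hs]
  have hne : ∀ᶠ t in 𝓝 (0 : ℝ), β t ≠ 0 := by
    apply hβc.continuousAt.eventually_ne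
    rwa [hβ0]
  have hd : ∀ t, fderiv ℝ q p (y t - p) = s t * (t * τ) := by
    intro t
    have : fderiv ℝ q p v = 0 := hv
    simp [hy, this, hτ]
  have hyN : ∀ᶠ t in 𝓝 (0 : ℝ), y t ∈ zeroSet q := by
    filter_upwards [hne] with t ht
    have h0 : q p = 0 := hp0
    have h1 := hd t
    rw [H.fderiv_apply] at h1
    have h2 : B (y t - p) (y t - p) = s t ^ 2 * β t := by
      simp [hy, hβ]
      ring
    have h3 : q (y t) = q p + (2 * B p (y t - p) + l (y t - p)) + B (y t - p) (y t - p) := by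
      rw [H.eq, H.eq]
      simp [H.symm (y t) p]
      ring
    change q (y t) = 0
    rw [h3, h0, h1, h2]
    simp only [hs]
    field_simp
    ring
  have hyt : Tendsto y (𝓝 0) (𝓝[zeroSet q] p) := by
    refine tendsto_nhdsWithin_iff.2 ⟨?_, hyN⟩
    have := hyc.tendsto
    rwa [hy0] at this
  have hsign : ∀ᶠ t in 𝓝 (0 : ℝ), 0 < β t * B v v := by
    have : ContinuousAt (fun t => β t * B v v) 0 := (hβc.mul continuous_const).continuousAt
    refine this.eventually_const_lt ?_
    change 0 < β 0 * B v v
    rw [hβ0]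
    exact mul_self_pos.2 hvv
  have hall := (hyt.eventually hP).and hsign
  have h3 : ∃ᶠ t : ℝ in 𝓝[>] 0, True := Filter.Eventually.frequently (by simp)
  obtain ⟨t, ⟨h1, h2⟩, ht⟩ :=
    ((hall.filter_mono (nhdsWithin_le_nhds (s := Ioi 0))).and self_mem_nhdsWithin).exists
  have ht : 0 < t := ht
  refine ⟨t ^ 2 * τ ^ 2 / (β t * B v v), by positivity, ?_⟩
  rw [hd] at h1
  convert h1 using 1
  have hβt : β t ≠ 0 := fun h => by simp [h] at h2
  simp only [hs]
  field_simp

/-- On each tangent hyperplane of a locally strictly convex quadric, the form `B` is definite. -/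
theorem definite (H : HasQuadraticForm q B l c) (hN : IsLocallyStrictlyConvex q) {p : E4}
    (hp0 : p ∈ zeroSet q) :
    ∃ ε : ℝ, (ε = 1 ∨ ε = -1) ∧ ∀ v ∈ hyperTangent q p, v ≠ 0 → 0 < ε * B v v := by
  obtain ⟨hp, hside, hnd⟩ := hN p hp0
  obtain ⟨ε, hε, hsemi⟩ : ∃ ε : ℝ, (ε = 1 ∨ ε = -1) ∧ ∀ v ∈ hyperTangent q p, 0 ≤ ε * B v v := by
    rcases hside with h | h
    · refine ⟨-1, Or.inr rfl, fun v hv => ?_⟩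
      by_contra hneg
      obtain ⟨r, hr, hle⟩ := H.exists_side hp0 hp hv (by rintro h0; simp [h0] at hneg) h
      nlinarith
    · refine ⟨1, Or.inl rfl, fun v hv => ?_⟩
      by_contra hneg
      obtain ⟨r, hr, hle⟩ := H.exists_side hp0 hp hv (by rintro h0; simp [h0] at hneg)
        (P := fun z => z ≤ 0) h
      nlinarith
  refine ⟨ε, hε, fun v hv hv0 => (hsemi v hv).lt_of_ne' fun h0 => hv0 (hnd v hv fun w hw => ?_)⟩
  rw [H.fderiv_hyperD hp0 hp hv hw]
  -- a null vector of a semidefinite form lies in its radical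
  have key : ∀ t : ℝ, 0 ≤ t * (2 * (ε * B w v)) + t * t * (ε * B w w) := fun t => by
    have := hsemi (v + t • w) (Submodule.add_mem _ hv (Submodule.smul_mem _ t hw))
    simp [H.symm v w] at this
    nlinarith
  have hww := hsemi w hw
  have h1 : ε * B w v = 0 := by
    have hd := discrim_le_zero (a := ε * B w w) (b := 2 * (ε * B w v)) (c := 0)
      (fun t => by nlinarith [key t])
    unfold discrim at hd
    nlinarith
  have hε0 : ε ≠ 0 := by rcases hε with rfl | rfl <;> norm_num
  rcases mul_eq_zero.1 h1 with h | h
  · exact absurd h hε0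
  · simp [h]

end HasQuadraticForm

/-- `Z p = a p + b` is a nonzero affine field with `2 B(Z p, ·) = a dq_p`. For `a ≠ 0` it is a
multiple of the radius vector from the centre of the quadric, for `a = 0` it is constant and spans
the radical of `B`. -/
def IsCentralField (B : E4 →L[ℝ] E4 →L[ℝ] ℝ) (l : E4 →L[ℝ] ℝ) (a : ℝ) (b : E4) : Prop :=
  (a ≠ 0 ∨ b ≠ 0) ∧ ∀ w, 2 * B b w = a * l w

theorem exists_isCentralField (B : E4 →L[ℝ] E4 →L[ℝ] ℝ) (l : E4 →L[ℝ] ℝ) :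
    ∃ a b, IsCentralField B l a b := by
  let L : ℝ × E4 →ₗ[ℝ] Module.Dual ℝ E4 :=
    { toFun := fun z => (((2 : ℝ) • B z.2 - z.1 • l : E4 →L[ℝ] ℝ) : E4 →ₗ[ℝ] ℝ)
      map_add' := fun z z' => by
        ext v
        simp
        ring
      map_smul' := fun r z => by
        ext v
        simp
        ring }
  have hL : L.ker ≠ ⊥ := by
    apply LinearMap.ker_ne_bot_of_finrank_lt
    rw [Subspace.dual_finrank_eq, Module.finrank_prod]
    simp
  obtain ⟨⟨a, b⟩, hz, hne⟩ := Submodule.exists_mem_ne_zero_of_ne_bot hL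
  refine ⟨a, b, ?_, fun w => ?_⟩
  · by_contra! h
    exact hne (Prod.ext h.1 h.2)
  · have := LinearMap.congr_fun (LinearMap.mem_ker.1 hz) w
    simp [L] at this
    linarith

namespace HasQuadraticForm

variable {q : E4 → ℝ} {B : E4 →L[ℝ] E4 →L[ℝ] ℝ} {l : E4 →L[ℝ] ℝ} {c a : ℝ} {b : E4}

theorem central_eq (hZ : IsCentralField B l a b) (p w : E4) :
    2 * B (a • p + b) w = a * (2 * B p w + l w) := by
  have := hZ.2 w
  simp
  linarith

theorem central_orthogonal (H : HasQuadraticForm q B l c) (hZ : IsCentralField B l a b)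
    {p w : E4} (hw : w ∈ hyperTangent q p) : B (a • p + b) w = 0 := by
  have h := central_eq hZ p w
  rw [H.mem_hyperTangent.1 hw] at h
  linarith

theorem fderiv_central (H : HasQuadraticForm q B l c) (hZ : IsCentralField B l a b)
    {p : E4} (hp : p ∈ zeroSet q) : fderiv ℝ q p (a • p + b) = l b - 2 * a * c := by
  have h0 : q p = 0 := hp
  rw [H.eq] at h0
  have h1 := hZ.2 p
  rw [H.fderiv_apply]
  simp [H.symm p b]
  linear_combination 2 * a * h0 + h1

theorem central_notMem (H : HasQuadraticForm q B l c) (hN : IsLocallyStrictlyConvex q)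
    (hZ : IsCentralField B l a b) {p : E4} (hp : p ∈ zeroSet q) :
    a • p + b ∉ hyperTangent q p := by
  intro hmem
  obtain ⟨ε, -, hdef⟩ := H.definite hN hp
  have h0 : a • p + b = 0 := by
    by_contra h
    have := hdef _ hmem h
    simp only [H.central_orthogonal hZ hmem, mul_zero, lt_irrefl] at this
  have ha : a ≠ 0 := by
    rintro rfl
    rcases hZ.1 with h | h
    · exact h rfl
    · exact h (by simpa using h0)
  refine (hN p hp).1 (ContinuousLinearMap.ext fun w => ?_)
  have h := central_eq hZ p w
  rw [h0, ← H.fderiv_apply] at h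
  simpa [ha] using h

theorem apply_eq_sum (B : E4 →L[ℝ] E4 →L[ℝ] ℝ) (x y : E4) :
    B x y = ∑ i, ∑ j, x i * B (EuclideanSpace.single i 1) (EuclideanSpace.single j 1) * y j := by
  have h : ∀ x : E4, x = ∑ i, x i • EuclideanSpace.single i (1 : ℝ) := fun x => by
    simpa using ((EuclideanSpace.basisFun (Fin 4) ℝ).sum_repr x).symm
  conv_lhs => rw [h x, h y]
  simp only [map_sum, map_smul, sum_apply, smul_apply,
    smul_eq_mul, Finset.mul_sum]
  rw [Finset.sum_comm]
  exact Finset.sum_congr rfl fun i _ => Finset.sum_congr rfl fun j _ => by ring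

theorem linear_eq_sum (l : E4 →L[ℝ] ℝ) (x : E4) :
    l x = ∑ i, x i * l (EuclideanSpace.single i 1) := by
  have h : ∀ x : E4, x = ∑ i, x i • EuclideanSpace.single i (1 : ℝ) := fun x => by
    simpa using ((EuclideanSpace.basisFun (Fin 4) ℝ).sum_repr x).symm
  conv_lhs => rw [h x]
  simp

/-- For the homogenised quadratic form on `ℝ⁵`, the Gram matrix of `u₀, u₁, u₂, Z p` (at infinity)
and of `p` has the determinant `-(τ²/4) det B(uᵢ, uⱼ)`, where `τ = dq_p(Z p)` does not depend on
`p`. Hence `det B(uᵢ, uⱼ)` is a constant multiple of `[u₀, u₁, u₂, Z p]²`. -/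
theorem exists_gram_eq (H : HasQuadraticForm q B l c) (hZ : IsCentralField B l a b)
    (hτ : l b - 2 * a * c ≠ 0) :
    ∃ k : ℝ, ∀ p ∈ zeroSet q, ∀ u : Fin 3 → E4, (∀ i, u i ∈ hyperTangent q p) →
      Matrix.det (Matrix.of fun i j : Fin 3 => B (u i) (u j)) =
        k * det4 (u 0) (u 1) (u 2) (a • p + b) ^ 2 := by
  set e : Fin 4 → E4 := fun i => EuclideanSpace.single i 1 with he
  set Q : Matrix (Fin 4 ⊕ Fin 1) (Fin 4 ⊕ Fin 1) ℝ :=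
    Matrix.fromBlocks (Matrix.of fun i j => B (e i) (e j)) (Matrix.of fun i _ => l (e i) / 2)
      (Matrix.of fun _ j => l (e j) / 2) (Matrix.of fun _ _ => c) with hQ
  set τ := l b - 2 * a * c with hτdef
  refine ⟨-4 * Q.det / τ ^ 2, fun p hp u hu => ?_⟩
  set Z := a • p + b with hZp
  set r : Fin 4 → E4 := ![u 0, u 1, u 2, Z] with hr
  set R : Matrix (Fin 4) (Fin 4) ℝ := Matrix.of fun i j => r i j with hR
  set P : Matrix (Fin 4 ⊕ Fin 1) (Fin 4 ⊕ Fin 1) ℝ :=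
    Matrix.fromBlocks R 0 (Matrix.of fun _ j => p j) 1 with hP
  have hdetP : P.det = det4 (u 0) (u 1) (u 2) Z := by
    rw [hP, Matrix.det_fromBlocks_zero₁₂]
    simp [hR, hr, det4]
  set G : Matrix (Fin 4 ⊕ Fin 1) (Fin 4 ⊕ Fin 1) ℝ :=
    Matrix.fromBlocks (Matrix.of fun i j => B (r i) (r j))
      (Matrix.of fun i _ => B p (r i) + l (r i) / 2)
      (Matrix.of fun _ j => B p (r j) + l (r j) / 2) (Matrix.of fun _ _ => q p) with hG
  have hPQ : P * Q * P.transpose = G := by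
    rw [hP, hQ, hG, Matrix.fromBlocks_transpose, Matrix.fromBlocks_multiply,
      Matrix.fromBlocks_multiply]
    congr 1 <;> ext i j
    · simp only [Matrix.of_apply, apply_eq_sum B (r i) (r j)]
      simp [Matrix.mul_apply, Finset.sum_mul, hR, he]
      rw [Finset.sum_comm]
    · simp only [Matrix.of_apply, H.symm p, apply_eq_sum B (r i) p, linear_eq_sum l (r i)]
      simp [Matrix.mul_apply, Finset.sum_mul, hR, he, Finset.sum_div, mul_div_assoc]
      rw [Finset.sum_comm]
    · simp only [Matrix.of_apply, apply_eq_sum B p (r j), linear_eq_sum l (r j)]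
      simp [Matrix.mul_apply, Finset.sum_mul, hR, he, Finset.sum_div, add_mul,
        Finset.sum_add_distrib]
      rw [Finset.sum_comm]
      congr 1
      exact Finset.sum_congr rfl fun k _ => by ring
    · simp only [Matrix.of_apply, H.eq, apply_eq_sum B p p, linear_eq_sum l p]
      simp [Matrix.mul_apply, Finset.sum_mul, he, add_mul, Finset.sum_add_distrib]
      rw [Finset.sum_comm]
      have : ∑ k, l (EuclideanSpace.single k 1) / 2 * p k =
        (1 / 2) * ∑ k, p k * l (EuclideanSpace.single k 1) := by
        rw [Finset.mul_sum]
        exact Finset.sum_congr rfl fun k _ => by ring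
      have h' : ∑ k, p k * (l (EuclideanSpace.single k 1) / 2) =
        (1 / 2) * ∑ k, p k * l (EuclideanSpace.single k 1) := by
        rw [Finset.mul_sum]
        exact Finset.sum_congr rfl fun k _ => by ring
      rw [this, h']
      ring
  have hdq : ∀ v, B p v + l v / 2 = fderiv ℝ q p v / 2 := fun v => by
    rw [H.fderiv_apply]
    ring
  have hu0 : ∀ i, B p (u i) + l (u i) / 2 = 0 := fun i => by
    have h : fderiv ℝ q p (u i) = 0 := hu i
    rw [hdq, h, zero_div]
  have hZ0 : B p Z + l Z / 2 = τ / 2 := by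
    rw [hdq, H.fderiv_central hZ hp]
  have hBZ : ∀ i, B Z (u i) = 0 := fun i => H.central_orthogonal hZ (hu i)
  have hBZ' : ∀ i, B (u i) Z = 0 := fun i => by rw [H.symm, hBZ]
  have hqp : q p = 0 := hp
  have hG5 : G.submatrix finSumFinEquiv.symm finSumFinEquiv.symm =
      !![B (u 0) (u 0), B (u 0) (u 1), B (u 0) (u 2), 0, 0;
         B (u 1) (u 0), B (u 1) (u 1), B (u 1) (u 2), 0, 0;
         B (u 2) (u 0), B (u 2) (u 1), B (u 2) (u 2), 0, 0;
         0, 0, 0, B Z Z, τ / 2;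
         0, 0, 0, τ / 2, 0] := by
    have hs : ∀ i : Fin 5, (finSumFinEquiv (m := 4) (n := 1)).symm i =
      ![Sum.inl 0, Sum.inl 1, Sum.inl 2, Sum.inl 3, Sum.inr 0] i := by decide
    ext i j
    rw [Matrix.submatrix_apply, hs, hs]
    fin_cases i <;> fin_cases j <;> simp [hG, hr, hu0, hZ0, hBZ, hBZ', hqp]
  have hdetG : G.det = -(τ ^ 2 / 4) * Matrix.det (Matrix.of fun i j => B (u i) (u j)) := by
    rw [← Matrix.det_submatrix_equiv_self (finSumFinEquiv (m := 4) (n := 1)).symm, hG5,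
      Matrix.det_fin_three]
    simp [Matrix.det_succ_row_zero, Fin.sum_univ_succ, Fin.succAbove]
    ring
  have hmain : G.det = Q.det * det4 (u 0) (u 1) (u 2) Z ^ 2 := by
    rw [← hPQ, Matrix.det_mul, Matrix.det_mul, Matrix.det_transpose, hdetP]
    ring
  rw [hdetG] at hmain
  field_simp
  linear_combination -4 * hmain

end HasQuadraticForm

/-! ### The affine normal and the Blaschke metric of a hyperquadric -/

theorem exists_isHyperFrame {q : E4 → ℝ} {p : E4} (hp : fderiv ℝ q p ≠ 0) :
    ∃ u, IsHyperFrame q p u := by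
  have hr : Module.finrank ℝ (hyperTangent q p) = 3 := by
    have h := Module.Dual.finrank_ker_add_one_of_ne_zero (K := ℝ) (V₁ := E4)
      (f := (fderiv ℝ q p : E4 →ₗ[ℝ] ℝ)) (by exact_mod_cast hp)
    rw [finrank_euclideanSpace_fin] at h
    unfold hyperTangent
    omega
  let bs := Module.finBasisOfFinrankEq ℝ (hyperTangent q p) hr
  refine ⟨fun i => bs i, ?_, ?_⟩
  · exact bs.linearIndependent.map' (hyperTangent q p).subtype (Submodule.ker_subtype _)
  · have h := congrArg (Submodule.map (hyperTangent q p).subtype) bs.span_eq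
    rw [Submodule.map_span, ← range_comp, Submodule.map_top, Submodule.range_subtype] at h
    exact h

theorem IsHyperFrame.mem {q : E4 → ℝ} {p : E4} {u : Fin 3 → E4} (hu : IsHyperFrame q p u)
    (i : Fin 3) : u i ∈ hyperTangent q p := by
  rw [← hu.2]
  exact Submodule.subset_span (mem_range_self i)

theorem det4_smul_add (u₀ u₁ u₂ z t : E4) (r : ℝ) :
    det4 u₀ u₁ u₂ (r • z + t) = r * det4 u₀ u₁ u₂ z + det4 u₀ u₁ u₂ t := by
  simp [det4, Matrix.det_succ_row_zero, Fin.sum_univ_succ, Fin.succAbove]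
  ring

theorem det4_eq_zero_of_mem_span {u : Fin 3 → E4} {t : E4} (ht : t ∈ Submodule.span ℝ (range u)) :
    det4 (u 0) (u 1) (u 2) t = 0 := by
  obtain ⟨d, rfl⟩ := (Submodule.mem_span_range_iff_exists_fun ℝ).1 ht
  rw [det4_sum_right]
  refine Finset.sum_eq_zero fun k _ => mul_eq_zero_of_right _ ?_
  fin_cases k
  · exact Matrix.det_zero_of_row_eq (i := 0) (j := 3) (by decide) rfl
  · exact Matrix.det_zero_of_row_eq (i := 1) (j := 3) (by decide) rfl
  · exact Matrix.det_zero_of_row_eq (i := 2) (j := 3) (by decide) rfl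

/-- If `dq_p z ≠ 0`, the determinant `[u₁, u₂, u₃, y]` only depends on `dq_p y`. -/
theorem IsHyperFrame.det4_eq {q : E4 → ℝ} {p : E4} {u : Fin 3 → E4} (hu : IsHyperFrame q p u)
    {z : E4} (hz : fderiv ℝ q p z ≠ 0) (y : E4) :
    det4 (u 0) (u 1) (u 2) y =
      fderiv ℝ q p y / fderiv ℝ q p z * det4 (u 0) (u 1) (u 2) z := by
  have ht : y - (fderiv ℝ q p y / fderiv ℝ q p z) • z ∈ hyperTangent q p := by
    change fderiv ℝ q p (y - (fderiv ℝ q p y / fderiv ℝ q p z) • z) = 0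
    rw [map_sub, map_smul, smul_eq_mul, div_mul_cancel₀ _ hz, sub_self]
  have h := det4_smul_add (u 0) (u 1) (u 2) z (y - (fderiv ℝ q p y / fderiv ℝ q p z) • z)
    (fderiv ℝ q p y / fderiv ℝ q p z)
  have h0 := det4_eq_zero_of_mem_span (u := u) (t := y - (fderiv ℝ q p y / fderiv ℝ q p z) • z)
    (by rwa [hu.2])
  rw [h0, add_sub_cancel, add_zero] at h
  exact h

theorem gram_det_pos {B : E4 →L[ℝ] E4 →L[ℝ] ℝ} (hB : ∀ x y, B x y = B y x) {T : Submodule ℝ E4}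
    {ε : ℝ} (hε : ε = 1 ∨ ε = -1) (hdef : ∀ v ∈ T, v ≠ 0 → 0 < ε * B v v) {u : Fin 3 → E4}
    (hu : LinearIndependent ℝ u) (huT : ∀ i, u i ∈ T) :
    0 < ε * Matrix.det (Matrix.of fun i j : Fin 3 => B (u i) (u j)) := by
  have hpd : (ε • Matrix.of fun i j : Fin 3 => B (u i) (u j)).PosDef := by
    refine Matrix.PosDef.of_dotProduct_mulVec_pos ?_ fun x hx => ?_
    · refine Matrix.IsHermitian.ext fun i j => ?_
      simp [hB (u i) (u j)]
    · have h1 := hdef (∑ i, x i • u i)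
        (Submodule.sum_mem _ fun i _ => Submodule.smul_mem _ _ (huT i))
        (fun h => hx (funext fun i => Fintype.linearIndependent_iff.1 hu x h i))
      refine h1.trans_eq ?_
      simp [dotProduct, Matrix.mulVec, Fin.sum_univ_succ]
      ring
  have h := hpd.det_pos
  rw [Matrix.det_smul, Fintype.card_fin] at h
  rcases hε with rfl | rfl
  · simpa using h
  · have h3 : (-1 : ℝ) ^ 3 = -1 := by norm_num
    rwa [h3] at h

theorem fifthRoot_pow_five (d : ℝ) : fifthRoot d ^ 5 = d := by
  rcases eq_or_ne d 0 with rfl | hd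
  · simp [fifthRoot]
  · unfold fifthRoot
    rw [mul_pow, ← Real.rpow_natCast (|d| ^ (1 / 5 : ℝ)), ← Real.rpow_mul (abs_nonneg d)]
    norm_num
    rcases lt_or_gt_of_ne hd with h | h
    · rw [Real.sign_of_neg h, abs_of_neg h]
      ring
    · rw [Real.sign_of_pos h, abs_of_pos h]
      ring

/-- A constant `k` with `det B(uᵢ, uⱼ) = k [u₀, u₁, u₂, Z p]²` for tangent vectors, together with
the fact that `k B` is positive definite on the tangent hyperplanes. -/
structure IsGramConstant (q : E4 → ℝ) (B : E4 →L[ℝ] E4 →L[ℝ] ℝ) (a : ℝ) (b : E4) (k : ℝ) :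
    Prop where
  det_eq : ∀ p ∈ zeroSet q, ∀ u : Fin 3 → E4, (∀ i, u i ∈ hyperTangent q p) →
    Matrix.det (Matrix.of fun i j : Fin 3 => B (u i) (u j)) =
      k * det4 (u 0) (u 1) (u 2) (a • p + b) ^ 2
  pos : ∀ p ∈ zeroSet q, ∀ v ∈ hyperTangent q p, v ≠ 0 → 0 < k * B v v
  ne_zero : k ≠ 0
  det4_ne_zero : ∀ p ∈ zeroSet q, ∀ u, IsHyperFrame q p u →
    det4 (u 0) (u 1) (u 2) (a • p + b) ≠ 0

namespace HasQuadraticForm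

variable {q : E4 → ℝ} {B : E4 →L[ℝ] E4 →L[ℝ] ℝ} {l : E4 →L[ℝ] ℝ} {c a k : ℝ} {b : E4}

theorem central_ne_zero (H : HasQuadraticForm q B l c) (hN : IsLocallyStrictlyConvex q)
    (hZ : IsCentralField B l a b) (hne : (zeroSet q).Nonempty) : l b - 2 * a * c ≠ 0 := by
  obtain ⟨p, hp⟩ := hne
  rw [← H.fderiv_central hZ hp]
  exact H.central_notMem hN hZ hp

theorem exists_isGramConstant (H : HasQuadraticForm q B l c) (hN : IsLocallyStrictlyConvex q)
    (hZ : IsCentralField B l a b) (hne : (zeroSet q).Nonempty) :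
    ∃ k, IsGramConstant q B a b k := by
  obtain ⟨k, hk⟩ := H.exists_gram_eq hZ (H.central_ne_zero hN hZ hne)
  have key : ∀ p ∈ zeroSet q, ∀ u, IsHyperFrame q p u → ∃ ε : ℝ, (ε = 1 ∨ ε = -1) ∧
      (∀ v ∈ hyperTangent q p, v ≠ 0 → 0 < ε * B v v) ∧
      0 < ε * (k * det4 (u 0) (u 1) (u 2) (a • p + b) ^ 2) := fun p hp u hu => by
    obtain ⟨ε, hε, hdef⟩ := H.definite hN hp
    refine ⟨ε, hε, hdef, ?_⟩
    rw [← hk p hp u hu.mem]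
    exact gram_det_pos H.symm hε hdef hu.1 hu.mem
  refine ⟨k, hk, fun p hp v hv hv0 => ?_, ?_, fun p hp u hu h0 => ?_⟩
  · obtain ⟨u, hu⟩ := exists_isHyperFrame (hN p hp).1
    obtain ⟨ε, hε, hdef, h⟩ := key p hp u hu
    have h1 := hdef v hv hv0
    have h2 : 0 < ε * k := by
      by_contra hneg
      nlinarith [sq_nonneg (det4 (u 0) (u 1) (u 2) (a • p + b))]
    have h3 := mul_pos h1 h2
    rcases hε with rfl | rfl <;> linarith
  · rintro rfl
    obtain ⟨p, hp⟩ := hne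
    obtain ⟨u, hu⟩ := exists_isHyperFrame (hN p hp).1
    obtain ⟨ε, hε, hdef, h⟩ := key p hp u hu
    simp at h
  · obtain ⟨ε, hε, hdef, h⟩ := key p hp u hu
    simp [h0] at h

theorem exists_isAffineNormal (H : HasQuadraticForm q B l c) (hN : IsLocallyStrictlyConvex q)
    (hZ : IsCentralField B l a b) (hne : (zeroSet q).Nonempty) (hk : IsGramConstant q B a b k) :
    ∃ Y, IsAffineNormal q Y := by
  have hτ := H.central_ne_zero hN hZ hne
  set τ := l b - 2 * a * c with hτdef
  set κ := fifthRoot (8 * |k| / |τ| ^ 3) with hκ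
  have hκ5 : κ ^ 5 = 8 * |k| / |τ| ^ 3 := fifthRoot_pow_five _
  have hkpos : 0 < |k| := abs_pos.2 hk.ne_zero
  have hτpos : 0 < |τ| := abs_pos.2 hτ
  have hκ5pos : 0 < κ ^ 5 := by
    rw [hκ5]
    positivity
  have hκpos : 0 < κ := by
    by_contra h
    exact absurd (Odd.pow_nonpos (by decide : Odd 5) (not_lt.1 h)) (not_le.2 hκ5pos)
  have hdY : ∀ p w : E4, fderiv ℝ (fun p => κ • (a • p + b)) p w = (κ * a) • w := fun p w => by
    have : HasFDerivAt (fun p : E4 => κ • (a • p + b))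
        (κ • (a • ContinuousLinearMap.id ℝ E4)) p :=
      (((hasFDerivAt_id p).const_smul a).add_const b).const_smul κ
    rw [this.fderiv]
    simp [smul_smul]
  refine ⟨fun p => κ • (a • p + b), ⟨fun p _ => ?_, fun p hp h => ?_, fun p _ w hw => ?_,
    fun p hp u hu h hh => ?_⟩⟩
  · fun_prop
  · exact H.central_notMem hN hZ hp ((Submodule.smul_mem_iff _ hκpos.ne').1 h)
  · rw [hdY]
    exact Submodule.smul_mem _ _ hw
  · have hh' : ∀ i j, h i j = -2 / (κ * τ) * B (u i) (u j) := fun i j => by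
      have h1 : fderiv ℝ q p (hyperD q p (u j) (u i) - h i j • κ • (a • p + b)) = 0 := hh i j
      rw [map_sub, H.fderiv_hyperD hp (hN p hp).1 (hu i) (hu j), map_smul, map_smul,
        H.fderiv_central hZ hp, H.symm (u j) (u i)] at h1
      simp only [smul_eq_mul] at h1
      field_simp
      linear_combination -h1
    have hmat : h = (-2 / (κ * τ)) • Matrix.of fun i j => B (u i) (u j) := by
      ext i j
      simp [hh']
    have hdet : det4 (u 0) (u 1) (u 2) (κ • (a • p + b)) =
        κ * det4 (u 0) (u 1) (u 2) (a • p + b) := by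
      have := det4_smul_add (u 0) (u 1) (u 2) (a • p + b) 0 κ
      have h0 : det4 (u 0) (u 1) (u 2) 0 = 0 := det4_eq_zero_of_mem_span (Submodule.zero_mem _)
      rwa [h0, add_zero, add_zero] at this
    rw [hmat, Matrix.det_smul, Fintype.card_fin, hk.det_eq p hp u hu, hdet, abs_mul, abs_mul,
      abs_pow, abs_div, abs_mul, abs_of_pos hκpos, abs_sq, mul_pow]
    norm_num
    field_simp at hκ5 ⊢
    linear_combination det4 (u 0) (u 1) (u 2) (a • p + b) ^ 2 * hκ5

/-- The transversal component `dq_p(Y p)` of an affine normal has constant absolute value. -/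
theorem abs_fderiv_affineNormal (H : HasQuadraticForm q B l c) (hN : IsLocallyStrictlyConvex q)
    (hZ : IsCentralField B l a b) (hk : IsGramConstant q B a b k) {Y : E4 → E4}
    (hY : IsAffineNormal q Y) {p : E4} (hp : p ∈ zeroSet q) :
    |fderiv ℝ q p (Y p)| ^ 5 = 8 * |k| * (l b - 2 * a * c) ^ 2 := by
  have hτ := H.central_ne_zero hN hZ ⟨p, hp⟩
  obtain ⟨u, hu⟩ := exists_isHyperFrame (hN p hp).1
  have hδ := hk.det4_ne_zero p hp u hu
  have hρ : fderiv ℝ q p (Y p) ≠ 0 := hY.transversal p hp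
  have hdet := hu.det4_eq (z := a • p + b) (by rwa [H.fderiv_central hZ hp]) (Y p)
  have hvol := hY.volume p hp u hu.mem
    ((-2 / fderiv ℝ q p (Y p)) • Matrix.of fun i j => B (u i) (u j)) fun i j => by
      change fderiv ℝ q p _ = 0
      rw [map_sub, H.fderiv_hyperD hp (hN p hp).1 (hu.mem i) (hu.mem j), map_smul,
        H.symm (u j) (u i)]
      simp
      field_simp
      ring
  rw [H.fderiv_central hZ hp] at hdet
  rw [Matrix.det_smul, Fintype.card_fin, hk.det_eq p hp u hu.mem, hdet, abs_mul, abs_mul, abs_pow,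
    abs_div, abs_sq] at hvol
  norm_num at hvol
  set ρ := fderiv ℝ q p (Y p)
  have hρpos : 0 < |ρ| := abs_pos.2 hρ
  rw [mul_pow, div_pow, ← sq_abs ρ] at hvol
  field_simp at hvol
  linear_combination hvol

/-- The Blaschke metric is a constant multiple of `B`. -/
theorem exists_blaschke_eq (H : HasQuadraticForm q B l c) (hN : IsLocallyStrictlyConvex q)
    (hZ : IsCentralField B l a b) (hne : (zeroSet q).Nonempty) (hk : IsGramConstant q B a b k) :
    ∃ s : ℝ, s ≠ 0 ∧ (∀ p ∈ zeroSet q, ∀ v ∈ hyperTangent q p, ∀ w ∈ hyperTangent q p,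
        blaschke q p v w = s * B v w) ∧
      ∀ p ∈ zeroSet q, ∀ v ∈ hyperTangent q p, v ≠ 0 → 0 < s * B v v := by
  have hτ := H.central_ne_zero hN hZ hne
  set τ := l b - 2 * a * c with hτdef
  set φ := fifthRoot ((-2 / τ) ^ 3 * k) with hφ
  have hφ5 : φ ^ 5 = (-2 / τ) ^ 3 * k := fifthRoot_pow_five _
  have hφ0 : φ ≠ 0 := by
    intro h
    have : (-2 / τ) ^ 3 * k ≠ 0 :=
      mul_ne_zero (pow_ne_zero _ (div_ne_zero (by norm_num) hτ)) hk.ne_zero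
    rw [← hφ5, h] at this
    simp at this
  refine ⟨-2 / τ / φ, div_ne_zero (div_ne_zero (by norm_num) hτ) hφ0, fun p hp v hv w hw => ?_, fun p hp v hv hv0 => ?_⟩
  · have hp' := (hN p hp).1
    obtain ⟨u, hu⟩ := exists_isHyperFrame hp'
    have hδ := hk.det4_ne_zero p hp u hu
    set δ := det4 (u 0) (u 1) (u 2) (a • p + b) with hδdef
    have hform : ∀ v ∈ hyperTangent q p, ∀ w ∈ hyperTangent q p,
        frameForm q p u v w = -2 / τ * δ * B v w := fun v hv w hw => by
      rw [frameForm, hu.det4_eq (z := a • p + b) (by rwa [H.fderiv_central hZ hp]),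
        H.fderiv_hyperD hp hp' hv hw, H.fderiv_central hZ hp, H.symm w v]
      ring
    have hmat : (Matrix.of fun i j : Fin 3 => frameForm q p u (u i) (u j)) =
        (-2 / τ * δ) • Matrix.of fun i j => B (u i) (u j) := by
      ext i j
      simp [hform _ (hu.mem i) _ (hu.mem j)]
    rw [blaschke_eq (H.contDiff.contDiffAt.of_le two_le_infty) hp' hu, normalizedForm, hmat,
      Matrix.det_smul, Fintype.card_fin, hk.det_eq p hp u hu.mem, hform v hv w hw,
      show (-2 / τ * δ) ^ 3 * (k * δ ^ 2) = δ ^ 5 * ((-2 / τ) ^ 3 * k) by ring,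
      fifthRoot_mul_pow hδ, ← hφ]
    field_simp
  · have h1 := hk.pos p hp v hv hv0
    -- `s` and `k` have the same sign, as `s³ k = φ²`
    have h2 : (-2 / τ / φ) ^ 3 * k = φ ^ 2 := by
      rw [div_pow, div_mul_eq_mul_div, ← hφ5]
      field_simp
    set s := -2 / τ / φ
    have h3 : 0 < s * k := by
      have : 0 < s ^ 2 * (s * k) := by
        rw [show s ^ 2 * (s * k) = s ^ 3 * k by ring, h2]
        positivity
      exact pos_of_mul_pos_right this (sq_nonneg s)
    have h4 := mul_pos h1 h3
    have h5 : 0 < k ^ 2 * (s * B v v) := by nlinarith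
    exact pos_of_mul_pos_right h5 (sq_nonneg k)

end HasQuadraticForm

/-! ### Immersed surfaces in a chart -/

/-- The coordinate plane. -/
abbrev E2 := EuclideanSpace ℝ (Fin 2)

section Chart

variable {M : Type*} [TopologicalSpace M] [ChartedSpace E2 M]

/-- The components of `v ∈ T_y M` in the chart centred at `x`. -/
def coordVec (x y : M) (v : TangentSpace (𝓡 2) y) : E2 :=
  mfderiv (𝓡 2) 𝓘(ℝ, E2) (extChartAt (𝓡 2) x) y v

/-- The surface `f` written in the chart centred at `x`. -/
def chartMap (f : M → E4) (x : M) : E2 → E4 := f ∘ (extChartAt (𝓡 2) x).symm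

/-- The field `y ↦ df_y (Y y)` written in the chart centred at `x`. -/
def chartPush (f : M → E4) (x : M) (Y : VField M) (u : E2) : E4 :=
  dmap f ((extChartAt (𝓡 2) x).symm u) (Y ((extChartAt (𝓡 2) x).symm u))

theorem chartPush_self (f : M → E4) (x : M) (Y : VField M) :
    chartPush f x Y (extChartAt (𝓡 2) x x) = dmap f x (Y x) := by
  rw [chartPush, extChartAt_to_inv]

theorem eventuallyEq_chart {V : Type*} {G : M → V} {x y : M}
    (hy : y ∈ (extChartAt (𝓡 2) x).source) :
    G =ᶠ[𝓝 y] (G ∘ (extChartAt (𝓡 2) x).symm) ∘ extChartAt (𝓡 2) x := by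
  filter_upwards [(isOpen_extChartAt_source x).mem_nhds hy] with z hz
  simp only [Function.comp_apply, (extChartAt (𝓡 2) x).left_inv hz]

variable [IsManifold (𝓡 2) ∞ M]

/-- The vector field on `M` with the constant components `v` in the chart centred at `x`. -/
def chartField (x : M) (v : E2) : VField M :=
  fun y => (trivializationAt E2 (TangentSpace (𝓡 2)) x).symm y v

theorem mfderiv_extChartAt_eq_trivialization {x y : M}
    (hy : y ∈ (extChartAt (𝓡 2) x).source) (v : TangentSpace (𝓡 2) y) :
    coordVec x y v = (trivializationAt E2 (TangentSpace (𝓡 2)) x ⟨y, v⟩).2 := by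
  rw [extChartAt_source] at hy
  have hb : y ∈ (trivializationAt E2 (TangentSpace (𝓡 2)) x).baseSet := by simpa using hy
  have h : coordVec x y v =
      (trivializationAt E2 (TangentSpace (𝓡 2)) x).continuousLinearMapAt ℝ y v :=
    congrArg (fun L => L v) (TangentBundle.continuousLinearMapAt_trivializationAt hy).symm
  rw [h, Bundle.Trivialization.continuousLinearMapAt_apply,
    Bundle.Trivialization.coe_linearMapAt_of_mem _ hb]

theorem coordVec_chartField {x y : M} (hy : y ∈ (extChartAt (𝓡 2) x).source) (v : E2) :
    coordVec x y (chartField x v y) = v := by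
  rw [mfderiv_extChartAt_eq_trivialization hy]
  rw [extChartAt_source] at hy
  have hb : y ∈ (trivializationAt E2 (TangentSpace (𝓡 2)) x).baseSet := by simpa using hy
  rw [chartField, Bundle.Trivialization.apply_mk_symm _ hb]

theorem coordVec_bijective {x y : M} (hy : y ∈ (extChartAt (𝓡 2) x).source) :
    Function.Bijective (coordVec x y) :=
  (isInvertible_mfderiv_extChartAt hy).bijective

theorem smoothAt_chartField (x : M) (v : E2) : (chartField x v).SmoothAt x := by
  refine (Bundle.contMDiffAt_section x).2 ?_
  refine (contMDiffAt_const (c := v)).congr_of_eventuallyEq ?_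
  filter_upwards [extChartAt_source_mem_nhds (I := 𝓡 2) x] with y hy
  rw [← mfderiv_extChartAt_eq_trivialization hy, coordVec_chartField hy]

theorem contDiffOn_chartMap {f : M → E4} (hf : IsSmoothImmersion f) (x : M) :
    ContDiffOn ℝ ∞ (chartMap f x) (extChartAt (𝓡 2) x).target :=
  (hf.1.comp_contMDiffOn (contMDiffOn_extChartAt_symm x)).contDiffOn

theorem contDiffAt_chartMap {f : M → E4} (hf : IsSmoothImmersion f) {x y : M}
    (hy : y ∈ (extChartAt (𝓡 2) x).source) :
    ContDiffAt ℝ ∞ (chartMap f x) (extChartAt (𝓡 2) x y) :=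
  (contDiffOn_chartMap hf x).contDiffAt
    ((isOpen_extChartAt_target x).mem_nhds ((extChartAt (𝓡 2) x).map_source hy))

/-- Derivatives on `M` can be computed in a chart. -/
theorem hasMFDerivAt_of_chart {V : Type*} [NormedAddCommGroup V] [NormedSpace ℝ V] {G : M → V}
    {Γ : E2 → V} {L : E2 →L[ℝ] V} {x y : M} (hy : y ∈ (extChartAt (𝓡 2) x).source)
    (hG : G =ᶠ[𝓝 y] Γ ∘ extChartAt (𝓡 2) x) (hΓ : HasFDerivAt Γ L (extChartAt (𝓡 2) x y))
    (v : TangentSpace (𝓡 2) y) :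
    mfderiv (𝓡 2) 𝓘(ℝ, V) G y v = L (coordVec x y v) := by
  have h1 : MDifferentiableAt (𝓡 2) 𝓘(ℝ, E2) (extChartAt (𝓡 2) x) y :=
    mdifferentiableAt_extChartAt (by rwa [extChartAt_source] at hy)
  have h2 := (hΓ.hasMFDerivAt.comp y h1.hasMFDerivAt).congr_of_eventuallyEq hG
  rw [h2.mfderiv]
  rfl

theorem dmap_eq {f : M → E4} (hf : IsSmoothImmersion f) {x y : M}
    (hy : y ∈ (extChartAt (𝓡 2) x).source) (v : TangentSpace (𝓡 2) y) :
    dmap f y v = fderiv ℝ (chartMap f x) (extChartAt (𝓡 2) x y) (coordVec x y v) :=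
  hasMFDerivAt_of_chart hy (eventuallyEq_chart hy)
    ((contDiffAt_chartMap hf hy).differentiableAt (by simp)).hasFDerivAt v

theorem tangentPlane_eq {f : M → E4} (hf : IsSmoothImmersion f) {x y : M}
    (hy : y ∈ (extChartAt (𝓡 2) x).source) :
    tangentPlane f y =
      LinearMap.range (fderiv ℝ (chartMap f x) (extChartAt (𝓡 2) x y) : E2 →ₗ[ℝ] E4) := by
  ext w
  constructor
  · rintro ⟨v, rfl⟩
    exact ⟨coordVec x y v, (dmap_eq hf hy v).symm⟩
  · rintro ⟨v, rfl⟩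
    obtain ⟨v', rfl⟩ := (coordVec_bijective hy).2 v
    exact ⟨v', dmap_eq hf hy v'⟩

/-- The components of a smooth field are differentiable. -/
theorem differentiableAt_coordVec {x : M} {Y : VField M} (hY : Y.SmoothAt x) :
    DifferentiableAt ℝ (fun u => coordVec x ((extChartAt (𝓡 2) x).symm u)
      (Y ((extChartAt (𝓡 2) x).symm u))) (extChartAt (𝓡 2) x x) := by
  have h1 := (Bundle.contMDiffAt_section x).1 hY
  have h2 : ContMDiffAt 𝓘(ℝ, E2) (𝓡 2) ∞ (extChartAt (𝓡 2) x).symm (extChartAt (𝓡 2) x x) :=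
    (contMDiffOn_extChartAt_symm x).contMDiffAt
      ((isOpen_extChartAt_target x).mem_nhds (mem_extChartAt_target x))
  have h3 := ContMDiffAt.comp (extChartAt (𝓡 2) x x) (by rwa [extChartAt_to_inv]) h2
  refine (h3.contDiffAt.differentiableAt (by simp)).congr_of_eventuallyEq ?_
  filter_upwards [(isOpen_extChartAt_target x).mem_nhds (mem_extChartAt_target (I := 𝓡 2) x)]
    with u hu
  exact mfderiv_extChartAt_eq_trivialization ((extChartAt (𝓡 2) x).map_target hu) _

theorem hasFDerivAt_chartPush {f : M → E4} (hf : IsSmoothImmersion f) {x : M} {Y : VField M}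
    (hY : Y.SmoothAt x) :
    ∃ R : E2 →L[ℝ] E2, HasFDerivAt (chartPush f x Y)
      ((fderiv ℝ (chartMap f x) (extChartAt (𝓡 2) x x)).comp R +
        (fderiv ℝ (fderiv ℝ (chartMap f x)) (extChartAt (𝓡 2) x x)).flip (coordVec x x (Y x)))
      (extChartAt (𝓡 2) x x) := by
  have h1 := (differentiableAt_coordVec hY).hasFDerivAt
  have h2 : DifferentiableAt ℝ (fderiv ℝ (chartMap f x)) (extChartAt (𝓡 2) x x) :=
    ((contDiffAt_chartMap hf (mem_extChartAt_source x)).fderiv_right (m := 1)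
      (by exact two_le_infty)).differentiableAt (by simp)
  have h3 := h2.hasFDerivAt.clm_apply h1
  refine ⟨fderiv ℝ (fun u => coordVec x ((extChartAt (𝓡 2) x).symm u)
    (Y ((extChartAt (𝓡 2) x).symm u))) (extChartAt (𝓡 2) x x), ?_⟩
  rw [extChartAt_to_inv] at h3
  refine h3.congr_of_eventuallyEq ?_
  filter_upwards [(isOpen_extChartAt_target x).mem_nhds (mem_extChartAt_target (I := 𝓡 2) x)]
    with u hu
  rw [chartPush, dmap_eq hf ((extChartAt (𝓡 2) x).map_target hu),
    (extChartAt (𝓡 2) x).right_inv hu]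

theorem differentiableAt_chartPush {f : M → E4} (hf : IsSmoothImmersion f) {x : M} {Y : VField M}
    (hY : Y.SmoothAt x) : DifferentiableAt ℝ (chartPush f x Y) (extChartAt (𝓡 2) x x) :=
  (hasFDerivAt_chartPush hf hY).choose_spec.differentiableAt

theorem flatD_eq {f : M → E4} (hf : IsSmoothImmersion f) {x : M} {Y : VField M}
    (hY : Y.SmoothAt x) (X : VField M) :
    flatD f X Y x =
      fderiv ℝ (chartPush f x Y) (extChartAt (𝓡 2) x x) (coordVec x x (X x)) :=
  hasMFDerivAt_of_chart (Γ := chartPush f x Y) (mem_extChartAt_source x)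
    (eventuallyEq_chart (G := fun y => dmap f y (Y y)) (mem_extChartAt_source x))
    (differentiableAt_chartPush hf hY).hasFDerivAt _

/-- Modulo the tangent plane, `D_X Y` is the second derivative of the parametrization. -/
theorem exists_flatD_eq {f : M → E4} (hf : IsSmoothImmersion f) {x : M} {Y : VField M}
    (hY : Y.SmoothAt x) (X : VField M) :
    ∃ t ∈ tangentPlane f x, flatD f X Y x =
      fderiv ℝ (fderiv ℝ (chartMap f x)) (extChartAt (𝓡 2) x x) (coordVec x x (X x))
        (coordVec x x (Y x)) + t := by
  obtain ⟨R, hR⟩ := hasFDerivAt_chartPush hf hY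
  refine ⟨fderiv ℝ (chartMap f x) (extChartAt (𝓡 2) x x) (R (coordVec x x (X x))), ?_, ?_⟩
  · rw [tangentPlane_eq hf (mem_extChartAt_source x)]
    exact ⟨_, rfl⟩
  · rw [flatD_eq hf hY, hR.fderiv, add_comm]
    rfl

theorem HasQuadraticForm.fderiv_fderiv_chartMap {q : E4 → ℝ} {B : E4 →L[ℝ] E4 →L[ℝ] ℝ}
    {l : E4 →L[ℝ] ℝ} {c : ℝ} (H : HasQuadraticForm q B l c) {f : M → E4}
    (hf : IsSmoothImmersion f) (hfN : ∀ x, f x ∈ zeroSet q) {x : M} {u : E2}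
    (hu : u ∈ (extChartAt (𝓡 2) x).target) (w : E2) :
    fderiv ℝ q (chartMap f x u) (fderiv ℝ (chartMap f x) u w) = 0 := by
  have hd : DifferentiableAt ℝ (chartMap f x) u :=
    ((contDiffOn_chartMap hf x).contDiffAt
      ((isOpen_extChartAt_target x).mem_nhds hu)).differentiableAt (by simp)
  have hz : q ∘ chartMap f x = fun _ => 0 := funext fun u => hfN _
  have h := (H.hasFDerivAt (chartMap f x u)).comp u hd.hasFDerivAt
  rw [hz] at h
  rw [H.fderiv_eq]
  exact congrArg (fun L => L w) (h.unique (hasFDerivAt_const (0 : ℝ) u))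

/-- The second derivative of a parametrization of a surface in a quadric: its component transversal
to the quadric is given by `B`. -/
theorem HasQuadraticForm.fderiv_fderiv_fderiv_chartMap {q : E4 → ℝ} {B : E4 →L[ℝ] E4 →L[ℝ] ℝ}
    {l : E4 →L[ℝ] ℝ} {c : ℝ} (H : HasQuadraticForm q B l c) {f : M → E4}
    (hf : IsSmoothImmersion f) (hfN : ∀ x, f x ∈ zeroSet q) (x : M) (v w : E2) :
    fderiv ℝ q (f x) (fderiv ℝ (fderiv ℝ (chartMap f x)) (extChartAt (𝓡 2) x x) v w) =
      -2 * B (fderiv ℝ (chartMap f x) (extChartAt (𝓡 2) x x) v)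
        (fderiv ℝ (chartMap f x) (extChartAt (𝓡 2) x x) w) := by
  set F := chartMap f x with hF
  set u₀ := extChartAt (𝓡 2) x x with hu₀
  have hFx : F u₀ = f x := by
    simp [hF, hu₀, chartMap]
  have hFd : ∀ u ∈ (extChartAt (𝓡 2) x).target, DifferentiableAt ℝ F u := fun u hu =>
    ((contDiffOn_chartMap hf x).contDiffAt
      ((isOpen_extChartAt_target x).mem_nhds hu)).differentiableAt (by simp)
  have h2 : DifferentiableAt ℝ (fderiv ℝ F) u₀ :=
    ((contDiffAt_chartMap hf (mem_extChartAt_source x)).fderiv_right (m := 1)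
      (by exact two_le_infty)).differentiableAt (by simp)
  have h3 : HasFDerivAt (fun u => fderiv ℝ q (F u)) (((2 : ℝ) • B).comp (fderiv ℝ F u₀)) u₀ := by
    rw [H.fderiv_eq]
    exact (((2 : ℝ) • B).hasFDerivAt.comp u₀
      (hFd u₀ (mem_extChartAt_target x)).hasFDerivAt).add_const l
  have h4 := h3.clm_apply (h2.hasFDerivAt.clm_apply (hasFDerivAt_const w u₀))
  have h5 : (fun u => fderiv ℝ q (F u) (fderiv ℝ F u w)) =ᶠ[𝓝 u₀] fun _ => 0 := by
    filter_upwards [(isOpen_extChartAt_target x).mem_nhds (mem_extChartAt_target (I := 𝓡 2) x)]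
      with u hu using H.fderiv_fderiv_chartMap hf hfN hu w
  have h6 := (h4.congr_of_eventuallyEq h5.symm).unique (hasFDerivAt_const (0 : ℝ) u₀)
  have h7 := congrArg (fun L => L v) h6
  simp [hFx] at h7
  linarith

end Chart

/-! ### The metric of the surface and the connections of plane bundles -/

theorem gram_pos_of_pair {β : E4 →L[ℝ] E4 →L[ℝ] ℝ} (hβ : ∀ x y, β x y = β y x) {t₁ t₂ : E4}
    (h : ∀ r s : ℝ, r ≠ 0 ∨ s ≠ 0 → 0 < β (r • t₁ + s • t₂) (r • t₁ + s • t₂)) :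
    0 < β t₁ t₁ * β t₂ t₂ - β t₁ t₂ ^ 2 := by
  have h1 := h 1 0 (by simp)
  have h2 := h (-β t₁ t₂) (β t₁ t₁) (Or.inr (by simpa using h1.ne'))
  simp only [map_add, map_smul, add_apply, smul_apply, smul_eq_mul, hβ t₂ t₁, one_smul, zero_smul,
    add_zero] at h1 h2
  have h3 : 0 < β t₁ t₁ * (β t₁ t₁ * β t₂ t₂ - β t₁ t₂ ^ 2) := by linarith
  exact pos_of_mul_pos_right h3 h1.le

section

variable {M : Type*} [TopologicalSpace M] [ChartedSpace E2 M]

/-- The `β`-orthogonal complement of the tangent plane. -/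
def normalPlane (β : E4 →L[ℝ] E4 →L[ℝ] ℝ) (f : M → E4) (x : M) : Submodule ℝ E4 where
  carrier := {v | ∀ w ∈ tangentPlane f x, β w v = 0}
  zero_mem' := fun w _ => map_zero _
  add_mem' := fun ha hb w hw => by rw [map_add, ha w hw, hb w hw, add_zero]
  smul_mem' := fun r v hv w hw => by rw [map_smul, hv w hw, smul_zero]

theorem isCompl_normalPlane {β : E4 →L[ℝ] E4 →L[ℝ] ℝ} (hβ : ∀ x y, β x y = β y x) {f : M → E4}
    {x : M} (hpos : ∀ v ∈ tangentPlane f x, v ≠ 0 → 0 < β v v) :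
    IsCompl (tangentPlane f x) (normalPlane β f x) := by
  let b : LinearMap.BilinForm ℝ E4 := LinearMap.mk₂ ℝ (fun x y => β x y)
    (by simp) (by simp) (by simp) (by simp)
  have hr : b.IsRefl := fun v w h => by
    change β w v = 0
    rw [hβ]
    exact h
  have hs : (b.restrict (tangentPlane f x)).IsRefl := fun v w h => hr v w h
  have hnd : (b.restrict (tangentPlane f x)).Nondegenerate := by
    refine hs.nondegenerate_iff_separatingLeft.2 fun v hv => ?_
    by_contra h0
    exact (hpos v v.2 (fun h => h0 (Subtype.ext h))).ne' (hv v)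
  exact LinearMap.BilinForm.isCompl_orthogonal_of_restrict_nondegenerate hr hnd

theorem dmap_mem (f : M → E4) (x : M) (v : TangentSpace (𝓡 2) x) :
    dmap f x v ∈ tangentPlane f x := ⟨v, rfl⟩

theorem flatD_sub_inducedConn_mem {f : M → E4} (hf : IsSmoothImmersion f)
    {σ : M → Submodule ℝ E4} {x : M} (hσ : IsCompl (tangentPlane f x) (σ x)) (X Y : VField M) :
    flatD f X Y x - dmap f x (inducedConn f σ X Y x) ∈ σ x := by
  have h : Function.Injective (dmap f x) ∧ IsCompl (LinearMap.range (dmap f x)) (σ x) :=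
    ⟨hf.2 x, hσ⟩
  rw [inducedConn, dif_pos h]
  refine (LinearMap.ker_linearProjOfIsCompl _ (dmap f x) h.1 h.2).le (LinearMap.mem_ker.2 ?_)
  rw [map_sub, LinearMap.linearProjOfIsCompl_apply_left, sub_self]

theorem exists_eq_smul_add {x : M} {E₁ E₂ : TangentSpace (𝓡 2) x}
    (h : LinearIndependent ℝ ![E₁, E₂]) (v : TangentSpace (𝓡 2) x) :
    ∃ r s : ℝ, v = r • E₁ + s • E₂ := by
  have hd : Module.finrank ℝ (TangentSpace (𝓡 2) x) = 2 :=
    finrank_euclideanSpace_fin (𝕜 := ℝ) (n := 2)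
  have : FiniteDimensional ℝ (TangentSpace (𝓡 2) x) := Module.finite_of_finrank_pos (by omega)
  have hs := h.span_eq_top_of_card_eq_finrank (by simp [hd])
  have hv : v ∈ Submodule.span ℝ (range ![E₁, E₂]) := hs ▸ Submodule.mem_top
  rw [Matrix.range_cons, Matrix.range_cons, Matrix.range_empty, union_empty,
    singleton_union, Submodule.mem_span_pair] at hv
  obtain ⟨r, s, h⟩ := hv
  exact ⟨r, s, h.symm⟩

/-- The derivative of the quotient defining the area form. -/
theorem hasDerivAt_areaQuotient {a b c d e₁₁ e₁₂ e₂₂ : ℝ → ℝ} {a' b' c' d' e₁₁' e₁₂' e₂₂' t : ℝ}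
    (ha : HasDerivAt a a' t) (hb : HasDerivAt b b' t) (hc : HasDerivAt c c' t)
    (hd : HasDerivAt d d' t) (h₁₁ : HasDerivAt e₁₁ e₁₁' t) (h₁₂ : HasDerivAt e₁₂ e₁₂' t)
    (h₂₂ : HasDerivAt e₂₂ e₂₂' t) (hpos : 0 < e₁₁ t * e₂₂ t - e₁₂ t ^ 2) :
    HasDerivAt (fun s => (a s * d s - b s * c s) / √(e₁₁ s * e₂₂ s - e₁₂ s ^ 2))
      ((a' * d t + a t * d' - b' * c t - b t * c' -
        (a t * d t - b t * c t) * (e₁₁' * e₂₂ t + e₁₁ t * e₂₂' - 2 * e₁₂ t * e₁₂') /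
          (2 * (e₁₁ t * e₂₂ t - e₁₂ t ^ 2))) / √(e₁₁ t * e₂₂ t - e₁₂ t ^ 2)) t := by
  have h1 := (ha.mul hd).sub (hb.mul hc)
  have h2 := ((h₁₁.mul h₂₂).sub (h₁₂.pow 2)).sqrt hpos.ne'
  refine (h1.div h2 (Real.sqrt_ne_zero'.2 hpos)).congr_deriv ?_
  simp only [Pi.mul_apply, Pi.sub_apply, Pi.pow_apply]
  set D := e₁₁ t * e₂₂ t - e₁₂ t ^ 2
  have hs : √D ≠ 0 := Real.sqrt_ne_zero'.2 hpos
  have hD : √D ^ 2 = D := Real.sq_sqrt hpos.le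
  generalize √D = r at *
  rw [← hD]
  field_simp
  push_cast
  ring

/-- The algebra behind `∇ω = 0` for a metric connection: `Y = y₁ E₁ + y₂ E₂`,
`Z = z₁ E₁ + z₂ E₂` and `∇Eᵢ = pᵢ₁ E₁ + pᵢ₂ E₂`, and the derivative of the Gram determinant is
twice the trace of `p` times it. -/
theorem areaQuotient_identity (y₁ y₂ z₁ z₂ p₁₁ p₁₂ p₂₁ p₂₂ e₁₁ e₁₂ e₂₂ : ℝ)
    (h : e₁₁ * e₂₂ - e₁₂ ^ 2 ≠ 0) :
    (y₁ * (p₁₁ * e₁₁ + p₁₂ * e₁₂) + y₂ * (p₁₁ * e₁₂ + p₁₂ * e₂₂)) * (z₁ * e₁₂ + z₂ * e₂₂) +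
      (y₁ * e₁₁ + y₂ * e₁₂) * (z₁ * (p₂₁ * e₁₁ + p₂₂ * e₁₂) + z₂ * (p₂₁ * e₁₂ + p₂₂ * e₂₂)) -
      (y₁ * (p₂₁ * e₁₁ + p₂₂ * e₁₂) + y₂ * (p₂₁ * e₁₂ + p₂₂ * e₂₂)) * (z₁ * e₁₁ + z₂ * e₁₂) -
      (y₁ * e₁₂ + y₂ * e₂₂) * (z₁ * (p₁₁ * e₁₁ + p₁₂ * e₁₂) + z₂ * (p₁₁ * e₁₂ + p₁₂ * e₂₂)) =
    ((y₁ * e₁₁ + y₂ * e₁₂) * (z₁ * e₁₂ + z₂ * e₂₂) -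
        (y₁ * e₁₂ + y₂ * e₂₂) * (z₁ * e₁₁ + z₂ * e₁₂)) *
      (2 * (p₁₁ * e₁₁ + p₁₂ * e₁₂) * e₂₂ + e₁₁ * (2 * (p₂₁ * e₁₂ + p₂₂ * e₂₂)) -
        2 * e₁₂ * ((p₁₁ * e₁₂ + p₁₂ * e₂₂) + (p₂₁ * e₁₁ + p₂₂ * e₁₂))) /
      (2 * (e₁₁ * e₂₂ - e₁₂ ^ 2)) := by
  field_simp
  ring

variable [IsManifold (𝓡 2) ∞ M]

theorem HasQuadraticForm.dmap_mem_hyperTangent {q : E4 → ℝ} {B : E4 →L[ℝ] E4 →L[ℝ] ℝ}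
    {l : E4 →L[ℝ] ℝ} {c : ℝ} (H : HasQuadraticForm q B l c) {f : M → E4}
    (hf : IsSmoothImmersion f) (hfN : ∀ x, f x ∈ zeroSet q) (x : M) (v : TangentSpace (𝓡 2) x) :
    dmap f x v ∈ hyperTangent q (f x) := by
  have h := H.fderiv_fderiv_chartMap hf hfN (mem_extChartAt_target x) (coordVec x x v)
  rw [← dmap_eq hf (mem_extChartAt_source x), chartMap, Function.comp_apply,
    extChartAt_to_inv] at h
  exact h

/-- The derivative of `β(Y, Z)` in the direction of `X`, along a line of a chart. -/
theorem hasDerivAt_pairing {f : M → E4} (hf : IsSmoothImmersion f) (β : E4 →L[ℝ] E4 →L[ℝ] ℝ)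
    {x : M} (X : VField M) {Y Z : VField M} (hY : Y.SmoothAt x) (hZ : Z.SmoothAt x) :
    HasDerivAt (fun t : ℝ =>
        β (chartPush f x Y (extChartAt (𝓡 2) x x + t • coordVec x x (X x)))
          (chartPush f x Z (extChartAt (𝓡 2) x x + t • coordVec x x (X x))))
      (β (flatD f X Y x) (dmap f x (Z x)) + β (dmap f x (Y x)) (flatD f X Z x)) 0 := by
  have h1 := (differentiableAt_chartPush hf hY).hasFDerivAt.hasLineDerivAt (coordVec x x (X x))
  have h2 := (differentiableAt_chartPush hf hZ).hasFDerivAt.hasLineDerivAt (coordVec x x (X x))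
  rw [← flatD_eq hf hY X] at h1
  rw [← flatD_eq hf hZ X] at h2
  have h1' : HasDerivAt (fun t : ℝ =>
      chartPush f x Y (extChartAt (𝓡 2) x x + t • coordVec x x (X x))) (flatD f X Y x) 0 := h1
  have h2' : HasDerivAt (fun t : ℝ =>
      chartPush f x Z (extChartAt (𝓡 2) x x + t • coordVec x x (X x))) (flatD f X Z x) 0 := h2
  have h3 := (β.hasFDerivAt.comp_hasDerivAt (0 : ℝ) h1').clm_apply h2'
  simp only [Function.comp_apply, zero_smul, add_zero, chartPush_self] at h3
  exact h3

theorem derivAlong_eq_of_hasDerivAt {x : M} {X : VField M} {φ : M → ℝ} {Γ : E2 → ℝ} {r : ℝ}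
    (hφ : ∀ u, φ ((extChartAt (𝓡 2) x).symm u) = Γ u)
    (hΓ : DifferentiableAt ℝ Γ (extChartAt (𝓡 2) x x))
    (h : HasDerivAt (fun t : ℝ => Γ (extChartAt (𝓡 2) x x + t • coordVec x x (X x))) r 0) :
    derivAlong X φ x = r := by
  have h1 := hasMFDerivAt_of_chart (G := φ) (Γ := Γ) (mem_extChartAt_source x)
    (by
      refine (eventuallyEq_chart (G := φ) (mem_extChartAt_source x)).trans (.of_eq ?_)
      exact funext fun z => hφ _)
    hΓ.hasFDerivAt (X x)
  have h2 : HasDerivAt (fun t : ℝ => Γ (extChartAt (𝓡 2) x x + t • coordVec x x (X x)))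
      (fderiv ℝ Γ (extChartAt (𝓡 2) x x) (coordVec x x (X x))) 0 :=
    hΓ.hasFDerivAt.hasLineDerivAt _
  rw [derivAlong, h.unique h2]
  exact h1

theorem differentiableAt_pairing {f : M → E4} (hf : IsSmoothImmersion f)
    (β : E4 →L[ℝ] E4 →L[ℝ] ℝ) {x : M} {Y Z : VField M} (hY : Y.SmoothAt x) (hZ : Z.SmoothAt x) :
    DifferentiableAt ℝ (fun u => β (chartPush f x Y u) (chartPush f x Z u))
      (extChartAt (𝓡 2) x x) :=
  (β.differentiableAt.comp _ (differentiableAt_chartPush hf hY)).clm_apply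
    (differentiableAt_chartPush hf hZ)

/-- For a metric given by the constant form `β`, `∇g` measures the failure of `σ` to be
`β`-orthogonal to the surface. -/
theorem nablaMetric_eq {f : M → E4} (hf : IsSmoothImmersion f) {β : E4 →L[ℝ] E4 →L[ℝ] ℝ}
    {g : ∀ x : M, TangentSpace (𝓡 2) x → TangentSpace (𝓡 2) x → ℝ}
    (hg : ∀ y v w, g y v w = β (dmap f y v) (dmap f y w)) (σ : M → Submodule ℝ E4) {x : M}
    (X : VField M) {Y Z : VField M} (hY : Y.SmoothAt x) (hZ : Z.SmoothAt x) :
    nablaMetric f σ g X Y Z x =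
      β (flatD f X Y x - dmap f x (inducedConn f σ X Y x)) (dmap f x (Z x)) +
        β (dmap f x (Y x)) (flatD f X Z x - dmap f x (inducedConn f σ X Z x)) := by
  have h := derivAlong_eq_of_hasDerivAt (φ := fun y => g y (Y y) (Z y))
    (fun u => hg _ _ _) (differentiableAt_pairing hf β hY hZ) (hasDerivAt_pairing hf β X hY hZ)
  rw [nablaMetric, h, hg, hg]
  simp only [map_sub, sub_apply]
  ring

theorem nablaMetric_normalPlane {f : M → E4} (hf : IsSmoothImmersion f)
    {β : E4 →L[ℝ] E4 →L[ℝ] ℝ} (hβ : ∀ x y, β x y = β y x)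
    {g : ∀ x : M, TangentSpace (𝓡 2) x → TangentSpace (𝓡 2) x → ℝ}
    (hg : ∀ y v w, g y v w = β (dmap f y v) (dmap f y w)) {x : M}
    (hpos : ∀ v ∈ tangentPlane f x, v ≠ 0 → 0 < β v v)
    (X : VField M) {Y Z : VField M} (hY : Y.SmoothAt x) (hZ : Z.SmoothAt x) :
    nablaMetric f (normalPlane β f) g X Y Z x = 0 := by
  have hc := isCompl_normalPlane hβ hpos
  have h1 := flatD_sub_inducedConn_mem hf hc X Y _ (dmap_mem f x (Z x))
  have h2 := flatD_sub_inducedConn_mem hf hc X Z _ (dmap_mem f x (Y x))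
  rw [nablaMetric_eq hf hg _ X hY hZ, hβ, h1, h2, add_zero]

/-- A Levi-Civita connection preserves the area form. -/
theorem nablaArea_normalPlane {f : M → E4} (hf : IsSmoothImmersion f)
    {β : E4 →L[ℝ] E4 →L[ℝ] ℝ} (hβ : ∀ x y, β x y = β y x)
    {g : ∀ x : M, TangentSpace (𝓡 2) x → TangentSpace (𝓡 2) x → ℝ}
    (hg : ∀ y v w, g y v w = β (dmap f y v) (dmap f y w)) {x : M}
    (hpos : ∀ v ∈ tangentPlane f x, v ≠ 0 → 0 < β v v)
    {E₁ E₂ : VField M} (hE₁ : E₁.SmoothAt x) (hE₂ : E₂.SmoothAt x)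
    (hE : LinearIndependent ℝ ![E₁ x, E₂ x])
    (X : VField M) {Y Z : VField M} (hY : Y.SmoothAt x) (hZ : Z.SmoothAt x) :
    nablaArea f (normalPlane β f) g E₁ E₂ X Y Z x = 0 := by
  have hc := isCompl_normalPlane hβ hpos
  set σ := normalPlane β f
  have hD : ∀ (W : VField M) (v : TangentSpace (𝓡 2) x), β (flatD f X W x) (dmap f x v) =
      β (dmap f x (inducedConn f σ X W x)) (dmap f x v) := fun W v => by
    have h := flatD_sub_inducedConn_mem hf hc X W _ (dmap_mem f x v)
    rw [hβ, map_sub, sub_apply, sub_eq_zero] at h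
    exact h
  have hD' : ∀ (W : VField M) (v : TangentSpace (𝓡 2) x), β (dmap f x v) (flatD f X W x) =
      β (dmap f x v) (dmap f x (inducedConn f σ X W x)) := fun W v => by
    rw [hβ, hD, hβ]
  -- the Gram determinant of a basis is positive
  have hgram : 0 < β (dmap f x (E₁ x)) (dmap f x (E₁ x)) * β (dmap f x (E₂ x)) (dmap f x (E₂ x)) -
      β (dmap f x (E₁ x)) (dmap f x (E₂ x)) ^ 2 := by
    have hpair := LinearIndependent.pair_iff.1 hE
    refine gram_pos_of_pair hβ fun r s hrs => ?_
    rw [← map_smul, ← map_smul, ← map_add]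
    refine hpos _ (dmap_mem f x _) fun h0 => ?_
    have := hpair r s (hf.2 x (h0.trans (map_zero (dmap f x)).symm))
    tauto
  have hline := hasDerivAt_areaQuotient
    (hasDerivAt_pairing hf β X hY hE₁) (hasDerivAt_pairing hf β X hY hE₂)
    (hasDerivAt_pairing hf β X hZ hE₁) (hasDerivAt_pairing hf β X hZ hE₂)
    (hasDerivAt_pairing hf β X hE₁ hE₁) (hasDerivAt_pairing hf β X hE₁ hE₂)
    (hasDerivAt_pairing hf β X hE₂ hE₂) (by simpa only [zero_smul, add_zero, chartPush_self] using hgram)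
  have hdiff : DifferentiableAt ℝ (fun u =>
      (β (chartPush f x Y u) (chartPush f x E₁ u) * β (chartPush f x Z u) (chartPush f x E₂ u) -
        β (chartPush f x Y u) (chartPush f x E₂ u) * β (chartPush f x Z u) (chartPush f x E₁ u)) /
      √(β (chartPush f x E₁ u) (chartPush f x E₁ u) * β (chartPush f x E₂ u) (chartPush f x E₂ u) -
        β (chartPush f x E₁ u) (chartPush f x E₂ u) ^ 2)) (extChartAt (𝓡 2) x x) := by
    have hg' : β (chartPush f x E₁ (extChartAt (𝓡 2) x x))
        (chartPush f x E₁ (extChartAt (𝓡 2) x x)) *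
        β (chartPush f x E₂ (extChartAt (𝓡 2) x x)) (chartPush f x E₂ (extChartAt (𝓡 2) x x)) -
        β (chartPush f x E₁ (extChartAt (𝓡 2) x x))
          (chartPush f x E₂ (extChartAt (𝓡 2) x x)) ^ 2 ≠ 0 := by
      simpa only [chartPush_self] using hgram.ne'
    simp only [div_eq_mul_inv]
    refine DifferentiableAt.fun_mul ?_ (DifferentiableAt.fun_inv (DifferentiableAt.sqrt (f := fun u =>
      β (chartPush f x E₁ u) (chartPush f x E₁ u) * β (chartPush f x E₂ u) (chartPush f x E₂ u) -
        β (chartPush f x E₁ u) (chartPush f x E₂ u) ^ 2) ?_ hg') ?_)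
    · exact ((differentiableAt_pairing hf β hY hE₁).mul (differentiableAt_pairing hf β hZ hE₂)).sub
        ((differentiableAt_pairing hf β hY hE₂).mul (differentiableAt_pairing hf β hZ hE₁))
    · exact ((differentiableAt_pairing hf β hE₁ hE₁).mul
        (differentiableAt_pairing hf β hE₂ hE₂)).sub
        ((differentiableAt_pairing hf β hE₁ hE₂).pow 2)
    · simpa only [chartPush_self] using (Real.sqrt_ne_zero'.2 hgram)
  have hder := derivAlong_eq_of_hasDerivAt
    (φ := fun y => areaForm (g y) (E₁ y) (E₂ y) (Y y) (Z y))
    (fun u => by simp only [areaForm, hg]; rfl) hdiff hline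
  rw [nablaArea, hder]
  simp only [zero_smul, add_zero, chartPush_self, areaForm, hg, hD, hD']
  rw [← sub_div, ← sub_div]
  refine div_eq_zero_iff.2 (Or.inl ?_)
  obtain ⟨y₁, y₂, hy⟩ := exists_eq_smul_add hE (Y x)
  obtain ⟨z₁, z₂, hz⟩ := exists_eq_smul_add hE (Z x)
  obtain ⟨p₁₁, p₁₂, hp₁⟩ := exists_eq_smul_add hE (inducedConn f σ X E₁ x)
  obtain ⟨p₂₁, p₂₂, hp₂⟩ := exists_eq_smul_add hE (inducedConn f σ X E₂ x)
  have hid := areaQuotient_identity y₁ y₂ z₁ z₂ p₁₁ p₁₂ p₂₁ p₂₂ _ _ _ hgram.ne'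
  rw [hy, hz, hp₁, hp₂]
  simp only [map_add, map_smul, add_apply, smul_apply, smul_eq_mul,
    hβ (dmap f x (E₂ x)) (dmap f x (E₁ x))]
  linear_combination hid

end

/-! ### The normal bundle is a transversal plane bundle -/

/-- For the Gram determinant `D` of `(t₁, t₂)`, the vector `D (w - π w)`, where `π` is the
`β`-orthogonal projection to the span of `t₁` and `t₂`. No division is needed. -/
def scaledNormalPart (β : E4 →L[ℝ] E4 →L[ℝ] ℝ) (w t₁ t₂ : E4) : E4 :=
  (β t₁ t₁ * β t₂ t₂ - β t₁ t₂ ^ 2) • w -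
    (β t₂ t₂ * β t₁ w - β t₁ t₂ * β t₂ w) • t₁ - (β t₁ t₁ * β t₂ w - β t₁ t₂ * β t₁ w) • t₂

theorem apply_scaledNormalPart {β : E4 →L[ℝ] E4 →L[ℝ] ℝ} (hβ : ∀ x y, β x y = β y x)
    (w t₁ t₂ : E4) (r s : ℝ) : β (r • t₁ + s • t₂) (scaledNormalPart β w t₁ t₂) = 0 := by
  simp only [scaledNormalPart, map_add, map_sub, map_smul, add_apply, smul_apply, smul_eq_mul,
    hβ t₂ t₁]
  ring

section

variable {M : Type*} [TopologicalSpace M] [ChartedSpace E2 M]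

theorem finrank_tangentPlane {f : M → E4} (hf : IsSmoothImmersion f) (x : M) :
    Module.finrank ℝ (tangentPlane f x) = 2 := by
  have hd : Module.finrank ℝ (TangentSpace (𝓡 2) x) = 2 :=
    finrank_euclideanSpace_fin (𝕜 := ℝ) (n := 2)
  rw [tangentPlane, LinearMap.finrank_range_of_inj (f := dmap f x) (hf.2 x), hd]

theorem finrank_of_isCompl_tangentPlane {f : M → E4} (hf : IsSmoothImmersion f) {x : M}
    {S : Submodule ℝ E4} (hS : IsCompl (tangentPlane f x) S) : Module.finrank ℝ S = 2 := by
  have h := Submodule.finrank_add_eq_of_isCompl hS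
  rw [finrank_tangentPlane hf, finrank_euclideanSpace_fin] at h
  omega

variable [IsManifold (𝓡 2) ∞ M]

theorem mem_tangentPlane_iff {f : M → E4} (hf : IsSmoothImmersion f) {x y : M}
    (hy : y ∈ (extChartAt (𝓡 2) x).source) {v : E4} :
    v ∈ tangentPlane f y ↔ ∃ r s : ℝ,
      v = r • fderiv ℝ (chartMap f x) (extChartAt (𝓡 2) x y) (EuclideanSpace.single 0 1) +
        s • fderiv ℝ (chartMap f x) (extChartAt (𝓡 2) x y) (EuclideanSpace.single 1 1) := by
  rw [tangentPlane_eq hf hy]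
  constructor
  · rintro ⟨w, rfl⟩
    refine ⟨w 0, w 1, ?_⟩
    have h : w = ∑ i, w i • EuclideanSpace.single i (1 : ℝ) := by
      simpa using ((EuclideanSpace.basisFun (Fin 2) ℝ).sum_repr w).symm
    conv_lhs => rw [h]
    simp [Fin.sum_univ_two]
  · rintro ⟨r, s, rfl⟩
    refine ⟨r • EuclideanSpace.single 0 1 + s • EuclideanSpace.single 1 1, ?_⟩
    simp

theorem fderiv_chartMap_injective {f : M → E4} (hf : IsSmoothImmersion f) (x : M) :
    Function.Injective (fderiv ℝ (chartMap f x) (extChartAt (𝓡 2) x x)) := by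
  refine (injective_iff_map_eq_zero _).2 fun v hv => ?_
  have hxs := mem_extChartAt_source (I := 𝓡 2) x
  obtain ⟨v', rfl⟩ := (coordVec_bijective hxs).2 v
  rw [← dmap_eq hf hxs] at hv
  have h0 : v' = 0 := hf.2 x (hv.trans (map_zero (dmap f x)).symm)
  rw [h0]
  exact map_zero (mfderiv (𝓡 2) 𝓘(ℝ, E2) (extChartAt (𝓡 2) x) x)

theorem contDiffOn_fderiv_chartMap {f : M → E4} (hf : IsSmoothImmersion f) (x : M) (e : E2) :
    ContDiffOn ℝ ∞ (fun u => fderiv ℝ (chartMap f x) u e) (extChartAt (𝓡 2) x).target :=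
  ((contDiffOn_chartMap hf x).fderiv_of_isOpen (isOpen_extChartAt_target x)
    (by exact le_rfl)).clm_apply contDiffOn_const

theorem isTransversalBundle_normalPlane {f : M → E4} (hf : IsSmoothImmersion f)
    {β : E4 →L[ℝ] E4 →L[ℝ] ℝ} (hβ : ∀ x y, β x y = β y x)
    (hpos : ∀ x, ∀ v ∈ tangentPlane f x, v ≠ 0 → 0 < β v v) {U : Set M} (hU : IsOpen U) :
    IsTransversalBundle f (normalPlane β f) U := by
  refine ⟨fun x _ => isCompl_normalPlane hβ (hpos x), fun x hx => ?_⟩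
  set t : Fin 2 → E2 → E4 := fun i u => fderiv ℝ (chartMap f x) u (EuclideanSpace.single i 1)
    with ht
  have htc : ∀ i, ContDiffOn ℝ ∞ (t i) (extChartAt (𝓡 2) x).target := fun i =>
    contDiffOn_fderiv_chartMap hf x _
  set ξ : E4 → E2 → E4 := fun w u => scaledNormalPart β w (t 0 u) (t 1 u) with hξ
  have hb : ∀ {a b : E2 → E4}, ContDiffOn ℝ ∞ a (extChartAt (𝓡 2) x).target →
      ContDiffOn ℝ ∞ b (extChartAt (𝓡 2) x).target →
      ContDiffOn ℝ ∞ (fun u => β (a u) (b u)) (extChartAt (𝓡 2) x).target := fun ha hb =>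
    (β.contDiff.comp_contDiffOn ha).clm_apply hb
  have hξc : ∀ w, ContDiffOn ℝ ∞ (ξ w) (extChartAt (𝓡 2) x).target := fun w => by
    have h0 := htc 0
    have h1 := htc 1
    have hw : ContDiffOn ℝ ∞ (fun _ : E2 => w) (extChartAt (𝓡 2) x).target := contDiffOn_const
    exact (((((hb h0 h0).mul (hb h1 h1)).sub ((hb h0 h1).pow 2)).smul hw).sub
      ((((hb h1 h1).mul (hb h0 hw)).sub ((hb h0 h1).mul (hb h1 hw))).smul h0)).sub
      ((((hb h0 h0).mul (hb h1 hw)).sub ((hb h0 h1).mul (hb h0 hw))).smul h1)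
  have hξM : ∀ w, ContMDiffOn (𝓡 2) 𝓘(ℝ, E4) ∞ (ξ w ∘ extChartAt (𝓡 2) x)
      (extChartAt (𝓡 2) x).source := fun w => by
    refine (hξc w).contMDiffOn.comp ?_ fun y hy => (extChartAt (𝓡 2) x).map_source hy
    rw [extChartAt_source]
    exact contMDiffOn_extChartAt
  have hmem : ∀ w, ∀ y ∈ (extChartAt (𝓡 2) x).source,
      ξ w (extChartAt (𝓡 2) x y) ∈ normalPlane β f y := fun w y hy v hv => by
    obtain ⟨r, s, rfl⟩ := (mem_tangentPlane_iff hf hy).1 hv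
    exact apply_scaledNormalPart hβ _ _ _ _ _
  -- a basis `w` of the normal plane at `x`
  have hcx := isCompl_normalPlane hβ (hpos x)
  let bs := Module.finBasisOfFinrankEq ℝ (normalPlane β f x)
    (finrank_of_isCompl_tangentPlane hf hcx)
  set w : Fin 2 → E4 := fun i => bs i with hw
  have hwli : LinearIndependent ℝ w :=
    bs.linearIndependent.map' (normalPlane β f x).subtype (Submodule.ker_subtype _)
  have hxs := mem_extChartAt_source (I := 𝓡 2) x
  set u₀ := extChartAt (𝓡 2) x x with hu₀
  set D := β (t 0 u₀) (t 0 u₀) * β (t 1 u₀) (t 1 u₀) - β (t 0 u₀) (t 1 u₀) ^ 2 with hD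
  have htm : ∀ i, t i u₀ ∈ tangentPlane f x := fun i => by
    rw [tangentPlane_eq hf hxs]
    exact ⟨_, rfl⟩
  have hξx : ∀ i, ξ (w i) u₀ = D • w i := fun i => by
    have h0 : β (t 0 u₀) (w i) = 0 := (bs i).2 _ (htm 0)
    have h1 : β (t 1 u₀) (w i) = 0 := (bs i).2 _ (htm 1)
    simp [hξ, scaledNormalPart, h0, h1, hD]
  have hD0 : D ≠ 0 := by
    refine (gram_pos_of_pair hβ fun r s hrs => ?_).ne'
    refine hpos x _ (Submodule.add_mem _ (Submodule.smul_mem _ _ (htm 0))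
      (Submodule.smul_mem _ _ (htm 1))) fun h0 => ?_
    have h1 : r • EuclideanSpace.single 0 1 + s • EuclideanSpace.single 1 1 = (0 : E2) :=
      fderiv_chartMap_injective hf x (by
        rw [map_add, map_smul, map_smul, map_zero]
        exact h0)
    have h2 := congrArg (fun v : E2 => v 0) h1
    have h3 := congrArg (fun v : E2 => v 1) h1
    simp at h2 h3
    tauto
  have hli : LinearIndependent ℝ (fun i => ξ (w i) u₀) := by
    simp only [hξx]
    exact hwli.units_smul fun _ => Units.mk0 D hD0
  have hcont : ContinuousAt (fun y => fun i => ξ (w i) (extChartAt (𝓡 2) x y)) x :=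
    continuousAt_pi.2 fun i => (((hξc (w i)).continuousOn.continuousAt
      ((isOpen_extChartAt_target x).mem_nhds (mem_extChartAt_target x))).comp
        (continuousAt_extChartAt x))
  have hev : ∀ᶠ y in 𝓝 x, LinearIndependent ℝ (fun i => ξ (w i) (extChartAt (𝓡 2) x y)) :=
    hcont.eventually (isOpen_setOfPred_linearIndependent.mem_nhds hli)
  obtain ⟨V, hV, hVo, hxV⟩ := mem_nhds_iff.1
    ((hev.and (extChartAt_source_mem_nhds (I := 𝓡 2) x)).and (hU.mem_nhds hx))
  refine ⟨V, hVo, hxV, fun y hy => (hV hy).2, ξ (w 0) ∘ extChartAt (𝓡 2) x,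
    ξ (w 1) ∘ extChartAt (𝓡 2) x, (hξM _).mono fun y hy => (hV hy).1.2,
    (hξM _).mono fun y hy => (hV hy).1.2, fun y hy => ?_⟩
  have hys : y ∈ (extChartAt (𝓡 2) x).source := (hV hy).1.2
  have hyl : LinearIndependent ℝ (fun i => ξ (w i) (extChartAt (𝓡 2) x y)) := (hV hy).1.1
  have hspan : Submodule.span ℝ (range fun i => ξ (w i) (extChartAt (𝓡 2) x y)) =
      normalPlane β f y := by
    refine Submodule.eq_of_le_of_finrank_eq ?_ ?_
    · rw [Submodule.span_le]
      rintro _ ⟨i, rfl⟩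
      exact hmem _ y hys
    · rw [finrank_span_eq_card hyl,
        finrank_of_isCompl_tangentPlane hf (isCompl_normalPlane hβ (hpos y)), Fintype.card_fin]
  rw [← hspan]
  congr 1
  ext v
  simp [Fin.exists_fin_two, eq_comm]

end

/-! ### Uniqueness away from inflections -/

theorem exists_orthonormal_pair {β : E4 →L[ℝ] E4 →L[ℝ] ℝ} (hβ : ∀ x y, β x y = β y x) {t₁ t₂ : E4}
    (h : ∀ r s : ℝ, r ≠ 0 ∨ s ≠ 0 → 0 < β (r • t₁ + s • t₂) (r • t₁ + s • t₂)) :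
    ∃ a c d : ℝ, β (a • t₁) (a • t₁) = 1 ∧ β (a • t₁) (c • t₁ + d • t₂) = 0 ∧
      β (c • t₁ + d • t₂) (c • t₁ + d • t₂) = 1 := by
  have hD := gram_pos_of_pair hβ h
  have hE : 0 < β t₁ t₁ := by simpa using h 1 0 (by simp)
  set E := β t₁ t₁
  set F := β t₁ t₂
  set G := β t₂ t₂
  have h1 : √E ^ 2 = E := Real.sq_sqrt hE.le
  have h2 : √(E * (E * G - F ^ 2)) ^ 2 = E * (E * G - F ^ 2) :=
    Real.sq_sqrt (mul_pos hE hD).le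
  have h3 : √E ≠ 0 := Real.sqrt_ne_zero'.2 hE
  have h4 : √(E * (E * G - F ^ 2)) ≠ 0 := Real.sqrt_ne_zero'.2 (mul_pos hE hD)
  refine ⟨1 / √E, -F / √(E * (E * G - F ^ 2)), E / √(E * (E * G - F ^ 2)), ?_, ?_, ?_⟩
  all_goals
    simp only [map_add, map_smul, add_apply, smul_apply, smul_eq_mul, hβ t₂ t₁]
  · change 1 / √E * (1 / √E * E) = 1
    field_simp
    exact h1.symm
  · change -F / √(E * (E * G - F ^ 2)) * (1 / √E * E) +
      E / √(E * (E * G - F ^ 2)) * (1 / √E * F) = 0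
    ring
  · change -F / √(E * (E * G - F ^ 2)) * (-F / √(E * (E * G - F ^ 2)) * E +
      E / √(E * (E * G - F ^ 2)) * F) + E / √(E * (E * G - F ^ 2)) *
      (-F / √(E * (E * G - F ^ 2)) * F + E / √(E * (E * G - F ^ 2)) * G) = 1
    generalize √(E * (E * G - F ^ 2)) = r at *
    field_simp
    linear_combination -h2

/-- The equiaffine equations and the (anti)symmetry equations, in an orthonormal basis in which the
second fundamental form in the direction tangent to the quadric is `!![p, r; r, s]`: the
determinant of the system is `4 r² + (p - s)²`. -/
theorem eq_zero_of_equations {p r s ε a₁ a₂ z₁ z₂ : ℝ} (hε : ε ^ 2 = 1)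
    (hn : 4 * r ^ 2 + (p - s) ^ 2 ≠ 0) (h₁ : p * a₁ + z₁ + r * a₂ = 0)
    (h₂ : r * a₁ + (s * a₂ + z₂) = 0) (h₃ : 2 * (r * a₁) + ε * (r * a₁ + (p * a₂ + z₂)) = 0)
    (h₄ : 2 * (r * a₂) + ε * (r * a₂ + (s * a₁ + z₁)) = 0) :
    a₁ = 0 ∧ a₂ = 0 ∧ z₁ = 0 ∧ z₂ = 0 := by
  have e₁ : 2 * r * a₁ + ε * (p - s) * a₂ = 0 := by linear_combination h₃ - ε * h₂
  have e₂ : 2 * r * a₂ + ε * (s - p) * a₁ = 0 := by linear_combination h₄ - ε * h₁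
  have ha₁ : a₁ = 0 := by
    refine (mul_eq_zero.1 (?_ : (4 * r ^ 2 + (p - s) ^ 2) * a₁ = 0)).resolve_left hn
    linear_combination 2 * r * e₁ - ε * (p - s) * e₂ - (p - s) ^ 2 * a₁ * hε
  have ha₂ : a₂ = 0 := by
    refine (mul_eq_zero.1 (?_ : (4 * r ^ 2 + (p - s) ^ 2) * a₂ = 0)).resolve_left hn
    linear_combination 2 * r * e₂ + ε * (p - s) * e₁ - (p - s) ^ 2 * a₂ * hε
  subst ha₁ ha₂
  refine ⟨rfl, rfl, ?_, ?_⟩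
  · linear_combination h₁
  · linear_combination h₂

section

variable {M : Type*} [TopologicalSpace M] [ChartedSpace E2 M]

theorem coordVec_smul_add_smul (x y : M) (r s : ℝ) (v w : TangentSpace (𝓡 2) y) :
    coordVec x y (r • v + s • w) = r • coordVec x y v + s • coordVec x y w := by
  unfold coordVec
  rw [map_add, map_smul, map_smul]
  rfl

/-- The projection to the tangent plane along a transversal plane. -/
theorem exists_tangential_projection {f : M → E4} (hf : IsSmoothImmersion f) {x : M}
    {S : Submodule ℝ E4} (hS : IsCompl (tangentPlane f x) S) :
    ∃ π : E4 →ₗ[ℝ] E4, (∀ v, π v ∈ tangentPlane f x) ∧ (∀ t ∈ tangentPlane f x, π t = t) ∧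
      ∀ v, v ∈ S ↔ π v = 0 := by
  refine ⟨dmap f x ∘ₗ LinearMap.linearProjOfIsCompl S (dmap f x) (hf.2 x) hS,
    fun v => dmap_mem f x _, ?_, fun v => ?_⟩
  · rintro _ ⟨v, rfl⟩
    exact congrArg (dmap f x)
      (LinearMap.linearProjOfIsCompl_apply_left S (dmap f x) (hf.2 x) hS v)
  · have hk := LinearMap.ker_linearProjOfIsCompl S (dmap f x) (hf.2 x) hS
    constructor
    · intro hv
      rw [← hk, LinearMap.mem_ker] at hv
      rw [LinearMap.comp_apply, hv, map_zero]
    · intro hv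
      refine hk.le (LinearMap.mem_ker.2 (hf.2 x ?_))
      exact hv.trans (map_zero (dmap f x)).symm

variable [IsManifold (𝓡 2) ∞ M]

theorem exists_orthonormal_chartField {f : M → E4} (hf : IsSmoothImmersion f)
    {β : E4 →L[ℝ] E4 →L[ℝ] ℝ} (hβ : ∀ x y, β x y = β y x) {x : M}
    (hpos : ∀ v ∈ tangentPlane f x, v ≠ 0 → 0 < β v v) :
    ∃ v : Fin 2 → E2, ∀ i j, β (fderiv ℝ (chartMap f x) (extChartAt (𝓡 2) x x) (v i))
      (fderiv ℝ (chartMap f x) (extChartAt (𝓡 2) x x) (v j)) = if i = j then 1 else 0 := by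
  set A := fderiv ℝ (chartMap f x) (extChartAt (𝓡 2) x x) with hA
  obtain ⟨a, c, d, h₁, h₂, h₃⟩ := exists_orthonormal_pair hβ
    (t₁ := A (EuclideanSpace.single 0 1)) (t₂ := A (EuclideanSpace.single 1 1)) fun r s hrs => by
      rw [← map_smul, ← map_smul, ← map_add]
      refine hpos _ ?_ fun h0 => ?_
      · rw [tangentPlane_eq hf (mem_extChartAt_source x)]
        exact ⟨_, rfl⟩
      · have h1 : r • EuclideanSpace.single 0 1 + s • EuclideanSpace.single 1 1 = (0 : E2) :=
          fderiv_chartMap_injective hf x (h0.trans (map_zero A).symm)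
        have h2 := congrArg (fun v : E2 => v 0) h1
        have h3 := congrArg (fun v : E2 => v 1) h1
        simp at h2 h3
        tauto
  refine ⟨![a • EuclideanSpace.single 0 1,
    c • EuclideanSpace.single 0 1 + d • EuclideanSpace.single 1 1], fun i j => ?_⟩
  have h₂' := h₂
  rw [hβ] at h₂'
  fin_cases i <;> fin_cases j
  all_goals
    simp only [Fin.zero_eta, Fin.mk_one, Matrix.cons_val_zero, Matrix.cons_val_one, map_smul A,
      map_add A]
  · rw [if_pos trivial]
    exact h₁
  · rw [if_neg (by decide)]
    exact h₂
  · rw [if_neg (by decide)]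
    exact h₂'
  · rw [if_pos trivial]
    exact h₃

/-- A conormal vector which annihilates the second derivatives of the parametrization in the
directions of a basis makes `x` an inflection. -/
theorem isInflection_of_conormal {f : M → E4} (hf : IsSmoothImmersion f) {x : M}
    {V : Fin 2 → TangentSpace (𝓡 2) x} (hV : LinearIndependent ℝ ![V 0, V 1]) {lam : E4 →ₗ[ℝ] ℝ}
    (hlam : lam ≠ 0) (hlamT : ∀ t ∈ tangentPlane f x, lam t = 0)
    (h : ∀ i j, lam (fderiv ℝ (fderiv ℝ (chartMap f x)) (extChartAt (𝓡 2) x x)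
      (coordVec x x (V i)) (coordVec x x (V j))) = 0) : IsInflection f x := by
  refine ⟨lam, hlam, hlamT, fun X Y _ hY => ?_⟩
  obtain ⟨t, htT, ht⟩ := exists_flatD_eq hf hY X
  obtain ⟨r₀, r₁, hr⟩ := exists_eq_smul_add hV (X x)
  obtain ⟨s₀, s₁, hs⟩ := exists_eq_smul_add hV (Y x)
  rw [ht, hr, hs, coordVec_smul_add_smul, coordVec_smul_add_smul]
  simp only [map_add, map_smul, add_apply, smul_apply, h, hlamT t htT, smul_zero, add_zero]

/-- At a point which is not an inflection, an equiaffine plane satisfying the symmetry (`ε = -1`)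
or the antisymmetry (`ε = 1`) equations is the normal plane. Here `θ` plays the role of `dq`, `Z`
that of the affine normal of the quadric, and `h_Z` expresses that the second fundamental form in
the direction of `Z` is a multiple of the metric. -/
theorem eq_normalPlane_of_equations {f : M → E4} (hf : IsSmoothImmersion f)
    {β : E4 →L[ℝ] E4 →L[ℝ] ℝ} (hβ : ∀ x y, β x y = β y x)
    {g : ∀ x : M, TangentSpace (𝓡 2) x → TangentSpace (𝓡 2) x → ℝ}
    (hg : ∀ y v w, g y v w = β (dmap f y v) (dmap f y w)) {x : M}
    {θ : E4 →L[ℝ] ℝ} (hθpos : ∀ v, θ v = 0 → v ≠ 0 → 0 < β v v)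
    (hθT : ∀ v ∈ tangentPlane f x, θ v = 0) {Z : E4} (hθZ : θ Z ≠ 0)
    (hβZ : ∀ v, θ v = 0 → β Z v = 0) {κ : ℝ} (hκ : κ ≠ 0)
    (h_Z : ∀ v w, θ (fderiv ℝ (fderiv ℝ (chartMap f x)) (extChartAt (𝓡 2) x x) v w) =
      κ * β (fderiv ℝ (chartMap f x) (extChartAt (𝓡 2) x x) v)
        (fderiv ℝ (chartMap f x) (extChartAt (𝓡 2) x x) w))
    (hinf : ¬ IsInflection f x) {σ : M → Submodule ℝ E4} {U : Set M} (hxU : x ∈ U)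
    (hσ : IsEquiaffine f g σ U) {ε : ℝ} (hε : ε ^ 2 = 1)
    (hsymm : ∀ X₁ X₂ : VField M, IsOrthonormalFrameAt g X₁ X₂ x →
      nablaMetric f σ g X₂ X₁ X₁ x + ε * nablaMetric f σ g X₁ X₂ X₁ x = 0 ∧
      nablaMetric f σ g X₁ X₂ X₂ x + ε * nablaMetric f σ g X₂ X₁ X₂ x = 0) :
    σ x = normalPlane β f x := by
  have hpos : ∀ v ∈ tangentPlane f x, v ≠ 0 → 0 < β v v := fun v hv => hθpos v (hθT v hv)
  have hxs := mem_extChartAt_source (I := 𝓡 2) x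
  have hc₀ := isCompl_normalPlane hβ hpos
  have hc := hσ.1.1 x hxU
  set N := normalPlane β f x with hN
  have hNT : ∀ n ∈ N, ∀ t ∈ tangentPlane f x, β n t = 0 := fun n hn t ht => by
    rw [hβ]
    exact hn t ht
  have hZN : Z ∈ N := fun t ht => by rw [hβ, hβZ t (hθT t ht)]
  -- `ν` spans the part of the normal plane which is tangent to the quadric
  obtain ⟨ν, hνN, hνθ, hν0⟩ : ∃ ν ∈ N, θ ν = 0 ∧ ν ≠ 0 := by
    have hk : ((θ : E4 →ₗ[ℝ] ℝ).domRestrict N).ker ≠ ⊥ := by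
      apply LinearMap.ker_ne_bot_of_finrank_lt
      rw [finrank_of_isCompl_tangentPlane hf hc₀]
      simp
    obtain ⟨ν, hν, hν0⟩ := Submodule.exists_mem_ne_zero_of_ne_bot hk
    exact ⟨ν, ν.2, hν, fun h => hν0 (Subtype.ext h)⟩
  have hνν : 0 < β ν ν := hθpos ν hνθ hν0
  have hspan : Submodule.span ℝ {ν, Z} = N := by
    have hli : LinearIndependent ℝ ![ν, Z] := by
      refine LinearIndependent.pair_iff.2 fun r s h => ?_
      have hs : s = 0 := by
        have := congrArg θ h
        simpa [hνθ, hθZ] using this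
      subst hs
      exact ⟨by simpa [hν0] using h, rfl⟩
    refine Submodule.eq_of_le_of_finrank_eq ?_ ?_
    · rw [Submodule.span_le]
      rintro v (rfl | rfl)
      · exact hνN
      · exact hZN
    · have h := finrank_span_eq_card hli
      rw [Matrix.range_cons, Matrix.range_cons, Matrix.range_empty, union_empty,
        singleton_union] at h
      rw [h, finrank_of_isCompl_tangentPlane hf hc₀, Fintype.card_fin]
  have hdecomp : ∀ n ∈ N, n = (β n ν / β ν ν) • ν + (θ n / θ Z) • Z := fun n hn => by
    rw [← hspan] at hn
    obtain ⟨r, s, rfl⟩ := Submodule.mem_span_pair.1 hn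
    have h1 : β (r • ν + s • Z) ν = r * β ν ν := by simp [hβZ ν hνθ]
    have h2 : θ (r • ν + s • Z) = s * θ Z := by simp [hνθ]
    rw [h1, h2, mul_div_cancel_right₀ _ hνν.ne', mul_div_cancel_right₀ _ hθZ]
  -- the orthonormal frame `X`, with constant components in the chart
  obtain ⟨v, hv⟩ := exists_orthonormal_chartField hf hβ hpos
  set X : Fin 2 → VField M := fun i => chartField x (v i) with hX
  have hXs : ∀ i, (X i).SmoothAt x := fun i => smoothAt_chartField x (v i)
  have hXc : ∀ i, coordVec x x (X i x) = v i := fun i => coordVec_chartField hxs (v i)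
  set e : Fin 2 → E4 := fun i => dmap f x (X i x) with he
  have he' : ∀ i, e i = fderiv ℝ (chartMap f x) (extChartAt (𝓡 2) x x) (v i) := fun i => by
    rw [he]
    simp only
    rw [dmap_eq hf hxs, hXc]
  have hee : ∀ i j, β (e i) (e j) = if i = j then 1 else 0 := fun i j => by rw [he', he', hv]
  have heT : ∀ i, e i ∈ tangentPlane f x := fun i => dmap_mem f x _
  have hgX : ∀ i j, g x (X i x) (X j x) = if i = j then 1 else 0 := fun i j => by
    rw [hg]
    exact hee i j
  have hXli : LinearIndependent ℝ ![X 0 x, X 1 x] := by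
    refine LinearIndependent.pair_iff.2 fun r s h => ?_
    have h1 : r • e 0 + s • e 1 = 0 := by
      simp only [he]
      rw [← map_smul, ← map_smul, ← map_add, h, map_zero]
    have h2 := congrArg (fun w => β w (e 0)) h1
    have h3 := congrArg (fun w => β w (e 1)) h1
    simpa [hee] using And.intro h2 h3
  have hXframe : IsOrthonormalFrameAt g (X 0) (X 1) x :=
    ⟨hXs 0, hXs 1, by rw [hgX]; rfl, by rw [hgX]; rfl, by rw [hgX]; rfl⟩
  set D : Fin 2 → Fin 2 → E4 := fun i j =>
    fderiv ℝ (fderiv ℝ (chartMap f x)) (extChartAt (𝓡 2) x x) (v i) (v j) with hDdef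
  set h : Fin 2 → Fin 2 → ℝ := fun i j => β (D i j) ν / β ν ν with hh
  have hhsymm : h 1 0 = h 0 1 := by
    have : D 1 0 = D 0 1 :=
      ((contDiffAt_chartMap hf hxs).of_le two_le_infty).isSymmSndFDerivAt (by simp) (v 1) (v 0)
    simp only [hh, this]
  -- the second fundamental form of the normal plane
  set n : Fin 2 → Fin 2 → E4 := fun i j =>
    flatD f (X i) (X j) x - dmap f x (inducedConn f (normalPlane β f) (X i) (X j) x) with hn
  have hnN : ∀ i j, n i j ∈ N := fun i j => flatD_sub_inducedConn_mem hf hc₀ (X i) (X j)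
  have hn' : ∀ i j, n i j = h i j • ν + (if i = j then κ / θ Z else 0) • Z := fun i j => by
    obtain ⟨t, htT, ht⟩ := exists_flatD_eq hf (hXs j) (X i)
    rw [hXc, hXc] at ht
    have h1 : β (n i j) ν = β (D i j) ν := by
      simp only [hn, ht, map_sub, map_add, sub_apply, add_apply]
      rw [hνN t htT, hνN _ (dmap_mem f x _)]
      ring
    have h2 : θ (n i j) = κ * if i = j then 1 else 0 := by
      simp only [hn, ht, map_sub, map_add]
      rw [hθT t htT, hθT _ (dmap_mem f x _), h_Z, hv]
      ring
    rw [hdecomp _ (hnN i j), h1, h2]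
    congr 2
    split_ifs <;> simp
  -- at a point which is not an inflection, `h` is not a multiple of the metric
  have hnondeg : 4 * h 0 1 ^ 2 + (h 0 0 - h 1 1) ^ 2 ≠ 0 := by
    intro h0
    have h01 : h 0 1 = 0 := by nlinarith [sq_nonneg (h 0 1), sq_nonneg (h 0 0 - h 1 1)]
    have h11 : h 1 1 = h 0 0 := by nlinarith [sq_nonneg (h 0 1), sq_nonneg (h 0 0 - h 1 1)]
    let lam : E4 →ₗ[ℝ] ℝ :=
      (κ • (β.flip ν) - (h 0 0 * β ν ν) • θ : E4 →L[ℝ] ℝ)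
    have hlam : ∀ w, lam w = κ * β w ν - h 0 0 * β ν ν * θ w := fun w => rfl
    have hDlam : ∀ i j, lam (D i j) = 0 := fun i j => by
      have h1 : β (D i j) ν = h i j * β ν ν := by simp only [hh]; field_simp
      rw [hlam, h1, hDdef]
      simp only
      rw [h_Z, hv]
      fin_cases i <;> fin_cases j <;> simp [h01, h11, hhsymm] <;> ring
    refine hinf (isInflection_of_conormal hf (V := ![X 0 x, X 1 x]) hXli (lam := lam) (fun hl => ?_) (fun t ht => ?_)
      fun i j => ?_)
    · have h1 := hlam ν
      rw [hl, hνθ] at h1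
      simp [hκ, hνν.ne'] at h1
    · rw [hlam, hνN t ht, hθT t ht]
      ring
    · have hVc : ∀ i, coordVec x x (![X 0 x, X 1 x] i) = v i := fun i => by
        fin_cases i
        · exact hXc 0
        · exact hXc 1
      rw [hVc, hVc]
      exact hDlam i j
  -- the difference of the two connections
  obtain ⟨π, hπT, hπt, hπσ⟩ := exists_tangential_projection hf hc
  set a := π ν with ha
  set z := (κ / θ Z) • π Z with hz
  have hK : ∀ i j, dmap f x (inducedConn f σ (X i) (X j) x) =
      dmap f x (inducedConn f (normalPlane β f) (X i) (X j) x) +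
        (h i j • a + if i = j then z else 0) := fun i j => by
    have h1 := (hπσ _).1 (flatD_sub_inducedConn_mem hf hc (X i) (X j))
    have h2 := congrArg π (hn' i j)
    simp only [hn, map_sub, map_add, map_smul] at h1 h2
    rw [hπt _ (dmap_mem f x _)] at h1 h2
    rw [← sub_eq_iff_eq_add', ← sub_eq_zero.1 h1, h2]
    congr 1
    split_ifs <;> simp [hz]
  have hmetric : ∀ i j k, nablaMetric f σ g (X i) (X j) (X k) x =
      -(β (h i j • a + if i = j then z else 0) (e k) +
        β (h i k • a + if i = k then z else 0) (e j)) := fun i j k => by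
    have h1 := hNT _ (hnN i j) _ (heT k)
    have h2 := hNT _ (hnN i k) _ (heT j)
    have h3 : ∀ j, flatD f (X i) (X j) x - dmap f x (inducedConn f σ (X i) (X j) x) =
        n i j - (h i j • a + if i = j then z else 0) := fun j => by
      rw [hK, ← sub_sub]
    have h4 : ∀ m y t : E4, β m t = 0 → β (m - y) t = -β y t := fun m y t h => by
      rw [map_sub, sub_apply, h, zero_sub]
    rw [nablaMetric_eq hf hg σ (X i) (hXs j) (hXs k), hβ (dmap f x (X j x)), h3, h3]
    exact (congrArg₂ (· + ·) (h4 _ _ _ h1) (h4 _ _ _ h2)).trans (neg_add _ _).symm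
  have harea : ∀ i, β (h i 0 • a + if i = 0 then z else 0) (e 0) +
      β (h i 1 • a + if i = 1 then z else 0) (e 1) = 0 := fun i => by
    have h1 := hσ.2 x hxU (X 0) (X 1) (X i) (X 0) (X 1) (hXs 0) (hXs 1) hXli (hXs i) (hXs 0) (hXs 1)
    have h2 := nablaArea_normalPlane hf hβ hg hpos (hXs 0) (hXs 1) hXli (X i) (hXs 0) (hXs 1)
    have h3 : ∀ w, areaForm (g x) (X 0 x) (X 1 x) w (X 1 x) = β (dmap f x w) (e 0) := fun w => by
      simp [areaForm, hgX, hg x w, he]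
    have h4 : ∀ w, areaForm (g x) (X 0 x) (X 1 x) (X 0 x) w = β (dmap f x w) (e 1) := fun w => by
      simp [areaForm, hgX, hg x w, he]
    rw [nablaArea, h3, h4] at h1 h2
    rw [hK, hK] at h1
    simp only [map_add, add_apply] at h1 h2 ⊢
    linear_combination h2 - h1
  have hs := hsymm (X 0) (X 1) hXframe
  simp only [hmetric] at hs
  have ha0 := harea 0
  have ha1 := harea 1
  simp [hhsymm] at hs ha0 ha1
  obtain ⟨h1, h2, h3, h4⟩ := eq_zero_of_equations (p := h 0 0) (r := h 0 1) (s := h 1 1)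
    (a₁ := β a (e 0)) (a₂ := β a (e 1)) (z₁ := β z (e 0)) (z₂ := β z (e 1)) hε hnondeg
    ha0 ha1 (by linear_combination -hs.1) (by linear_combination -hs.2)
  -- a tangent vector orthogonal to the frame vanishes
  have hzero : ∀ w ∈ tangentPlane f x, β w (e 0) = 0 → β w (e 1) = 0 → w = 0 := by
    rintro _ ⟨w, rfl⟩ hw₀ hw₁
    obtain ⟨r, s, rfl⟩ := exists_eq_smul_add hXli w
    have h5 : dmap f x (r • X 0 x + s • X 1 x) = r • e 0 + s • e 1 := by
      rw [map_add, map_smul, map_smul]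
    rw [h5] at hw₀ hw₁ ⊢
    simp [hee] at hw₀ hw₁
    simp [hw₀, hw₁]
  have hν' : ν ∈ σ x := (hπσ ν).2 (hzero _ (hπT ν) h1 h2)
  have hz0 : z = 0 := hzero _ (Submodule.smul_mem _ _ (hπT Z)) h3 h4
  have hZ' : Z ∈ σ x := (hπσ Z).2 ((smul_eq_zero.1 hz0).resolve_left (div_ne_zero hκ hθZ))
  refine (Submodule.eq_of_le_of_finrank_eq ?_ ?_).symm
  · rw [← hspan, Submodule.span_le]
    rintro w (rfl | rfl)
    · exact hν'
    · exact hZ'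
  · rw [finrank_of_isCompl_tangentPlane hf hc₀, finrank_of_isCompl_tangentPlane hf hc]

end

/-! ### Surfaces in a hyperquadric -/

section

variable {M : Type*} [TopologicalSpace M] [ChartedSpace E2 M] [IsManifold (𝓡 2) ∞ M]
  {q : E4 → ℝ} {B : E4 →L[ℝ] E4 →L[ℝ] ℝ} {l : E4 →L[ℝ] ℝ} {c a k : ℝ} {b : E4}

/-- The function `dq(Y)` has constant square along the surface, and its derivative in the direction
of a tangent vector `w` is `2 B(w, Y)`, because `Y` is equiaffine. -/
theorem HasQuadraticForm.affineNormal_orthogonal (H : HasQuadraticForm q B l c)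
    (hN : IsLocallyStrictlyConvex q) (hZ : IsCentralField B l a b)
    (hk : IsGramConstant q B a b k) {f : M → E4} (hf : IsSmoothImmersion f)
    (hfN : ∀ x, f x ∈ zeroSet q) {Y : E4 → E4} (hY : IsAffineNormal q Y) {x : M} {w : E4}
    (hw : w ∈ tangentPlane f x) : B w (Y (f x)) = 0 := by
  have hxs := mem_extChartAt_source (I := 𝓡 2) x
  set F := chartMap f x with hF
  set u₀ := extChartAt (𝓡 2) x x with hu₀
  have hFx : F u₀ = f x := by simp only [hF, hu₀, chartMap, Function.comp_apply, extChartAt_to_inv]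
  have hwq : w ∈ hyperTangent q (f x) := by
    obtain ⟨v, rfl⟩ := hw
    exact H.dmap_mem_hyperTangent hf hfN x v
  rw [tangentPlane_eq hf hxs] at hw
  obtain ⟨v, rfl⟩ := hw
  have hFd : HasFDerivAt F (fderiv ℝ F u₀) u₀ :=
    ((contDiffAt_chartMap hf hxs).differentiableAt (by simp)).hasFDerivAt
  have hYd : HasFDerivAt Y (fderiv ℝ Y (f x)) (F u₀) := by
    rw [hFx]
    exact ((hY.smooth _ (hfN x)).differentiableAt (by simp)).hasFDerivAt
  set ρ : E2 → ℝ := fun u => fderiv ℝ q (F u) (Y (F u)) with hρ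
  have hdq : HasFDerivAt (fun u => fderiv ℝ q (F u)) (((2 : ℝ) • B).comp (fderiv ℝ F u₀)) u₀ := by
    rw [H.fderiv_eq]
    exact (((2 : ℝ) • B).hasFDerivAt.comp u₀ hFd).add_const l
  have hρd := hdq.clm_apply (hYd.comp u₀ hFd)
  have hρ0 : ρ u₀ ≠ 0 := by
    simp only [hρ, hFx]
    exact hY.transversal _ (hfN x)
  have habs : ∀ u, ρ u ^ 2 = ρ u₀ ^ 2 := fun u => by
    have h1 := H.abs_fderiv_affineNormal hN hZ hk hY (p := F u) (hfN _)
    have h2 := H.abs_fderiv_affineNormal hN hZ hk hY (p := F u₀) (hfN _)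
    have h3 : |ρ u| = |ρ u₀| :=
      (pow_left_inj₀ (abs_nonneg _) (abs_nonneg _) (by norm_num : 5 ≠ 0)).1 (h1.trans h2.symm)
    rw [← sq_abs, h3, sq_abs]
  have hsq := (hρd.pow 2).unique
    ((hasFDerivAt_const (ρ u₀ ^ 2) u₀).congr_of_eventuallyEq (.of_eq (funext habs)))
  have hv := congrArg (fun L => L v) hsq
  have htan : fderiv ℝ q (f x) (fderiv ℝ Y (f x) (fderiv ℝ F u₀ v)) = 0 :=
    hY.equiaffine _ (hfN x) _ hwq
  have hρ0' : fderiv ℝ q (f x) (Y (f x)) ≠ 0 := hY.transversal _ (hfN x)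
  simp [hFx, htan, hρ0'] at hv
  exact hv

/-- If `s B` is the Blaschke metric, the `B`-normal planes of the surface form the unique equiaffine
plane bundle which is antisymmetric (`ε = 1`) or symmetric (`ε = -1`). -/
theorem HasQuadraticForm.normalPlane_unique (H : HasQuadraticForm q B l c)
    (hN : IsLocallyStrictlyConvex q) (hZ : IsCentralField B l a b) {s : ℝ} (hs : s ≠ 0)
    (hpos : ∀ p ∈ zeroSet q, ∀ v ∈ hyperTangent q p, v ≠ 0 → 0 < s * B v v)
    {f : M → E4} (hf : IsSmoothImmersion f) (hfN : ∀ x, f x ∈ zeroSet q)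
    {g : ∀ x : M, TangentSpace (𝓡 2) x → TangentSpace (𝓡 2) x → ℝ}
    (hg : ∀ y v w, g y v w = (s • B) (dmap f y v) (dmap f y w)) {U : Set M}
    (hU : ∀ x ∈ U, ¬ IsInflection f x) {σ : M → Submodule ℝ E4} (hσ : IsEquiaffine f g σ U)
    {ε : ℝ} (hε : ε ^ 2 = 1)
    (hsymm : ∀ x ∈ U, ∀ X₁ X₂ : VField M, IsOrthonormalFrameAt g X₁ X₂ x →
      nablaMetric f σ g X₂ X₁ X₁ x + ε * nablaMetric f σ g X₁ X₂ X₁ x = 0 ∧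
      nablaMetric f σ g X₁ X₂ X₂ x + ε * nablaMetric f σ g X₂ X₁ X₂ x = 0) :
    EqOn σ (normalPlane (s • B) f) U := by
  intro x hx
  have hβ : ∀ v w, (s • B) v w = (s • B) w v := fun v w => by
    simp [H.symm v w]
  refine eq_normalPlane_of_equations hf hβ hg (θ := fderiv ℝ q (f x)) (Z := a • f x + b)
    (κ := -2 / s) (hpos _ (hfN x)) ?_ (H.central_notMem hN hZ (hfN x)) (fun v hv => ?_)
    (div_ne_zero (by norm_num) hs) (fun v w => ?_) (hU x hx) hx hσ hε (hsymm x hx)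
  · rintro _ ⟨v, rfl⟩
    exact H.dmap_mem_hyperTangent hf hfN x v
  · rw [smul_apply, smul_apply, H.central_orthogonal hZ hv, smul_zero]
  · rw [H.fderiv_fderiv_fderiv_chartMap hf hfN, smul_apply, smul_apply, smul_eq_mul]
    field_simp

end

end

end AffineSurface

theorem mainTheorem1 {M : Type*} [TopologicalSpace M]
    [ChartedSpace (EuclideanSpace ℝ (Fin 2)) M] [IsManifold (𝓡 2) ∞ M]
    (q : E4 → ℝ) (hq : IsQuadratic q) (hN : IsLocallyStrictlyConvex q)
    (f : M → E4) (hf : IsSmoothImmersion f) (hfN : ∀ x, f x ∈ zeroSet q) :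
    (∃ Y : E4 → E4, IsAffineNormal q Y) ∧
    ∀ U : Set M, IsOpen U → (∀ x ∈ U, ¬ IsInflection f x) →
      (∃ σ : M → Submodule ℝ E4,
        IsAntisymmetricEquiaffine f (restrictedBlaschke q f) σ U ∧
        (∀ σ' : M → Submodule ℝ E4,
          IsAntisymmetricEquiaffine f (restrictedBlaschke q f) σ' U → EqOn σ' σ U) ∧
        ∀ Y : E4 → E4, IsAffineNormal q Y → ∀ x ∈ U, Y (f x) ∈ σ x) ∧
      (∃ σ : M → Submodule ℝ E4,
        IsSymmetricEquiaffine f (restrictedBlaschke q f) σ U ∧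
        (∀ σ' : M → Submodule ℝ E4,
          IsSymmetricEquiaffine f (restrictedBlaschke q f) σ' U → EqOn σ' σ U) ∧
        ∀ Y : E4 → E4, IsAffineNormal q Y → ∀ x ∈ U, Y (f x) ∈ σ x) := by
  obtain ⟨B, l, c, H⟩ := hq.exists_hasQuadraticForm
  rcases (zeroSet q).eq_empty_or_nonempty with hemp | hne
  · -- all conditions on `Y` and on the plane bundles are empty
    have hM : ∀ x : M, False := fun x => by simpa [hemp] using hfN x
    have hY : IsAffineNormal q fun _ => 0 := by
      constructor <;> simp [hemp]
    have hE : ∀ U : Set M, IsEquiaffine f (restrictedBlaschke q f) (fun _ => ⊥) U := fun U =>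
      ⟨⟨fun x => (hM x).elim, fun x => (hM x).elim⟩, fun x => (hM x).elim⟩
    exact ⟨⟨_, hY⟩, fun U _ _ =>
      ⟨⟨fun _ => ⊥, ⟨hE U, fun x => (hM x).elim⟩, fun _ _ x => (hM x).elim,
        fun _ _ x => (hM x).elim⟩,
      ⟨fun _ => ⊥, ⟨hE U, fun x => (hM x).elim⟩, fun _ _ x => (hM x).elim,
        fun _ _ x => (hM x).elim⟩⟩⟩
  obtain ⟨a, b, hZ⟩ := exists_isCentralField B l
  obtain ⟨k, hk⟩ := H.exists_isGramConstant hN hZ hne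
  obtain ⟨s, hs, hbl, hpos⟩ := H.exists_blaschke_eq hN hZ hne hk
  refine ⟨H.exists_isAffineNormal hN hZ hne hk, fun U hU hinf => ?_⟩
  have hβ : ∀ v w, (s • B) v w = (s • B) w v := fun v w => by simp [H.symm v w]
  have hT := H.dmap_mem_hyperTangent hf hfN
  have hg : ∀ y v w, restrictedBlaschke q f y v w = (s • B) (dmap f y v) (dmap f y w) :=
    fun y v w => hbl _ (hfN y) _ (hT y v) _ (hT y w)
  have hposT : ∀ x, ∀ v ∈ tangentPlane f x, v ≠ 0 → 0 < (s • B) v v := by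
    rintro x _ ⟨v, rfl⟩ hv
    exact hpos _ (hfN x) _ (hT x v) hv
  have hmetric : ∀ x, ∀ X Y Z : VField M, Y.SmoothAt x → Z.SmoothAt x →
      nablaMetric f (normalPlane (s • B) f) (restrictedBlaschke q f) X Y Z x = 0 :=
    fun x X _ _ hY hZ => nablaMetric_normalPlane hf hβ hg (hposT x) X hY hZ
  have hequi : IsEquiaffine f (restrictedBlaschke q f) (normalPlane (s • B) f) U :=
    ⟨isTransversalBundle_normalPlane hf hβ hposT hU,
      fun x _ _ _ X _ _ h₁ h₂ h₁₂ _ hY hZ =>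
        nablaArea_normalPlane hf hβ hg (hposT x) h₁ h₂ h₁₂ X hY hZ⟩
  have hnormal : ∀ Y, IsAffineNormal q Y → ∀ x ∈ U, Y (f x) ∈ normalPlane (s • B) f x :=
    fun Y hY x _ w hw => by
      rw [smul_apply, smul_apply, H.affineNormal_orthogonal hN hZ hk hf hfN hY hw, smul_zero]
  refine ⟨⟨normalPlane (s • B) f, ⟨hequi, fun x _ X₁ X₂ hX => ?_⟩, fun σ hσ => ?_, hnormal⟩,
    ⟨normalPlane (s • B) f, ⟨hequi, fun x _ X₁ X₂ hX => ?_⟩, fun σ hσ => ?_, hnormal⟩⟩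
  · simp only [hmetric x _ _ _ hX.1 hX.1, hmetric x _ _ _ hX.1 hX.2.1, hmetric x _ _ _ hX.2.1 hX.1,
      hmetric x _ _ _ hX.2.1 hX.2.1, add_zero, and_self]
  · exact H.normalPlane_unique hN hZ hs hpos hf hfN hg hinf hσ.1 (ε := 1) (by norm_num)
      fun x hx X₁ X₂ hX => by simpa only [one_mul] using hσ.2 x hx X₁ X₂ hX
  · simp only [hmetric x _ _ _ hX.1 hX.1, hmetric x _ _ _ hX.1 hX.2.1, hmetric x _ _ _ hX.2.1 hX.1,
      hmetric x _ _ _ hX.2.1 hX.2.1, sub_zero, and_self]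
  · exact H.normalPlane_unique hN hZ hs hpos hf hfN hg hinf hσ.1 (ε := -1) (by norm_num)
      fun x hx X₁ X₂ hX => by
        simpa only [neg_one_mul, ← sub_eq_add_neg] using hσ.2 x hx X₁ X₂ hX
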